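/- **Theorem (Approximation telescope of maps).** All CDGAs are commutative differential graded $\mathbb{Q}$-algebras, non-negatively and cohomologically graded. Let $\mathcal{A},\mathcal{B}$ be simply-connected CDGAs ($H^0=\mathbb{Q}$, $H^1=0$) and let $f:\mathcal{A}\to\mathcal{B}$ be a CDGA homomorphism. Then $f$ admits a minimal model built via an approximation telescope. This means the following. *Conventions.* A homotopy from $p$ to $q$, where $p,q:\mathcal{X}\to\mathcal{Y}$, is a CDGA map $H:\mathcal{X}\to\mathcal{Y}\otimes\Lambda(t,dt)$ with $(\mathrm{id}\cdot\varepsilon_0)H=p$ and $(\mathrm{id}\cdot\varepsilon_1)H=q$, where $\varepsilon_c$ sets $t=c$, $dt=0$; its integral $\int_0^1H$ is formed with the sign rule $b\otimes\omega\mapsto(-1)^{|b|}\left(\int_0^1\omega\right) b$, so that $d\int_0^1H+\int_0^1H\,d=q-p$. The cochain cone of $m:\mathcal{M}\to\mathcal{A}$ is $C_m^k=\mathcal{M}^{k+1}\oplus\mathcal{A}^k$ with $d(v,a)=(dv,m(v)-da)$. A Hirsch extension $\mathcal{M}\to\mathcal{M}\langle V\rangle$ of degree $k$ along a vector space $V$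 is the pushout of $\Lambda S^{k+1}(V)\to\Lambda D^{k+1}(V)$ along a map $\Lambda S^{k+1}(V)\to\mathcal{M}$: it freely adjoins generators $V$ in degree $k$ with prescribed cocycles of $\mathcal{M}$ as differentials. A minimal algebra is a CDGA $\mathcal{M}$ with an exhaustive filtration $\mathbb{Q}=\mathcal{M}_{(0)}\subseteq\mathcal{M}_{(1)}\subseteq\cdots$ in which $\mathcal{M}_{(k-1)}\subseteq\mathcal{M}_{(k)}$ is a Hirsch extension of degree $k$; it is $k$-minimal if the filtration stops at $\mathcal{M}_{(k)}=\mathcal{M}$. A minimal model of $\mathcal{A}$ is a quasi-isomorphism $\mathcal{M}\to\mathcal{A}$ from a minimal algebra; a $k$-minimal model is a map $\mathcal{M}\to\mathcal{A}$ from a $k$-minimal algebra that is bijective on $H^i$ for $i\le k$ and injective on $H^{k+1}$. A ($k$-)minimal model of $f$ consists of ($k$-)minimal models $m:\mathcal{M}\to\mathcal{A}$ and $n:\mathcal{N}\to\mathcal{B}$, a CDGA map $g:\mathcal{M}\to\mathcal{N}$ and a homotopy $H$ from $fm$ to $ng$; it induces a cochain map $\varphi:C_m\to C_n$, $\varphi(v,a)=\left(g(v),f(a)+\int_0^1H(v)\right)$.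 *Claim.* There are squares $(\mathcal{M}_k,\mathcal{N}_k,g_k,m_k,n_k,H_k)$, $k\ge1$, the $k$-th of which is a $k$-minimal model of $f$, such that $\mathcal{M}_1=\mathcal{N}_1=\mathbb{Q}$ and, for each $k\ge2$: 1. there are Hirsch extensions of degree $k$, $\mathcal{M}_{k-1}\to\mathcal{M}_k=\mathcal{M}_{k-1}\langle H^kC_{m_{k-1}}\rangle$ and $\mathcal{N}_{k-1}\to\mathcal{N}_k=\mathcal{N}_{k-1}\langle H^kC_{n_{k-1}}\rangle$, along which $g_k,m_k,n_k,H_k$ extend $g_{k-1},m_{k-1},n_{k-1},H_{k-1}$; 2. for each class $\alpha\in H^kC_{m_{k-1}}$, the pair formed by the differential $d\alpha\in\mathcal{M}_{k-1}$ of the corresponding new generator and its image $m_k(\alpha)$ is a cocycle of $C_{m_{k-1}}$ representing $\alpha$, and similarly for $\mathcal{N}_k$ and $n_k$; 3. on the new generators $g_k$ agrees with $H^k\varphi_{k-1}:H^kC_{m_{k-1}}\to H^kC_{n_{k-1}}$ modulo decomposable elements of $\mathcal{N}_k$. Moreover, the colimit of this tower, that is, the square with $\mathcal{M}_\infty=\mathrm{colim}_k\,\mathcal{M}_k$,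 $\mathcal{N}_\infty=\mathrm{colim}_k\,\mathcal{N}_k$ and the maps $g_\infty,m_\infty,n_\infty$ and homotopy $H_\infty$ induced on the colimits, exists and is a minimal model of $f$. -/

import Mathlib

universe u v w

noncomputable section

open scoped TensorProduct DirectSum Polynomial

/-- A (unital, non-negatively graded, cohomological) commutative differential graded algebra
over `ℚ`: a graded `ℚ`-algebra `⨁ n, deg n` with a differential of degree `+1` that is a graded
derivation, and whose multiplication is graded-commutative. -/
structure CDGA : Type (u + 1) where
  carrier : Type u
  [ring : Ring carrier]
  [algebra : Algebra ℚ carrier]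
  deg : ℕ → Submodule ℚ carrier
  [graded : GradedAlgebra deg]
  d : carrier →ₗ[ℚ] carrier
  d_mem : ∀ {n : ℕ} {a : carrier}, a ∈ deg n → d a ∈ deg (n + 1)
  d_d : ∀ a : carrier, d (d a) = 0
  leibniz : ∀ {n : ℕ} {a : carrier}, a ∈ deg n → ∀ b : carrier,
    d (a * b) = d a * b + (-1 : ℚ) ^ n • (a * d b)
  graded_comm : ∀ {i j : ℕ} {a b : carrier}, a ∈ deg i → b ∈ deg j →
    a * b = (-1 : ℚ) ^ (i * j) • (b * a)

namespace CDGA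

instance : CoeSort CDGA.{u} (Type u) := ⟨CDGA.carrier⟩

attribute [instance] CDGA.ring CDGA.algebra CDGA.graded

/-- A homomorphism of CDGAs: a unital algebra homomorphism preserving degrees and commuting with
the differentials. -/
structure Hom (A : CDGA.{u}) (B : CDGA.{v}) where
  toAlgHom : A →ₐ[ℚ] B
  map_deg : ∀ {n : ℕ} {a : A}, a ∈ A.deg n → toAlgHom a ∈ B.deg n
  map_d : ∀ a : A, toAlgHom (A.d a) = B.d (toAlgHom a)

instance (A : CDGA.{u}) (B : CDGA.{v}) : CoeFun (Hom A B) (fun _ => A → B) :=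
  ⟨fun f => f.toAlgHom⟩

/-- The underlying linear map of a homomorphism. -/
def Hom.lin {A : CDGA.{u}} {B : CDGA.{v}} (f : Hom A B) : A →ₗ[ℚ] B := f.toAlgHom.toLinearMap

@[simp] theorem Hom.lin_apply {A : CDGA.{u}} {B : CDGA.{v}} (f : Hom A B) (a : A) :
    f.lin a = f a := rfl

@[ext] theorem Hom.ext {A : CDGA.{u}} {B : CDGA.{v}} {f g : Hom A B} (h : ∀ a, f a = g a) :
    f = g := by
  cases f; cases g; congr; exact AlgHom.ext h

/-- Composition of homomorphisms (`g` after `f`). -/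
def Hom.comp {A : CDGA.{u}} {B : CDGA.{v}} {C : CDGA.{w}} (g : Hom B C) (f : Hom A B) :
    Hom A C where
  toAlgHom := g.toAlgHom.comp f.toAlgHom
  map_deg h := g.map_deg (f.map_deg h)
  map_d a := by simp [f.map_d, g.map_d]

@[simp] theorem Hom.comp_apply {A : CDGA.{u}} {B : CDGA.{v}} {C : CDGA.{w}} (g : Hom B C)
    (f : Hom A B) (a : A) : g.comp f a = g (f a) := rfl

/-- The sign operator `a ↦ (-1)^|a| a`. -/
def sign (A : CDGA.{u}) : A →ₗ[ℚ] A :=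
  DirectSum.toModule ℚ ℕ A (fun n => (-1 : ℚ) ^ n • (A.deg n).subtype) ∘ₗ
    (DirectSum.decomposeLinearEquiv A.deg).toLinearMap

theorem sign_of_mem (A : CDGA.{u}) {n : ℕ} {a : A} (ha : a ∈ A.deg n) :
    A.sign a = (-1 : ℚ) ^ n • a := by
  have h : DirectSum.decomposeLinearEquiv A.deg a = DirectSum.lof ℚ ℕ _ n ⟨a, ha⟩ :=
    DirectSum.decomposeLinearEquiv_apply_coe A.deg n ⟨a, ha⟩
  simp [sign, h]

/-- Linear maps out of a CDGA are determined by their values on homogeneous elements. -/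
theorem lin_ext (A : CDGA.{u}) {N : Type*} [AddCommMonoid N] [Module ℚ N] {f g : A →ₗ[ℚ] N}
    (h : ∀ n, ∀ a ∈ A.deg n, f a = g a) : f = g :=
  DirectSum.decompose_lhom_ext A.deg fun n => LinearMap.ext fun a => h n a a.2

/-! ### Tensor products -/

section Tensor

variable (A : CDGA.{u}) (B : CDGA.{v})

/-- The underlying graded tensor product algebra of `A ⊗ B`, whose multiplication is
`(a ⊗ b)(a' ⊗ b') = (-1)^(|b||a'|) aa' ⊗ bb'`. -/
abbrev TensorCarrier : Type (max u v) := GradedTensorProduct ℚ A.deg B.deg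

/-- The pure tensor `a ⊗ b`. -/
abbrev pure (a : A) (b : B) : TensorCarrier A B :=
  GradedTensorProduct.tmul ℚ (𝒜 := A.deg) (ℬ := B.deg) a b

/-- The degree `n` part of `A ⊗ B`, spanned by the `a ⊗ b` with `|a| + |b| = n`. -/
def tensorDeg (n : ℕ) : Submodule ℚ (TensorCarrier A B) :=
  Submodule.span ℚ {x | ∃ i j : ℕ, i + j = n ∧ ∃ a ∈ A.deg i, ∃ b ∈ B.deg j, x = pure A B a b}

/-- The differential `d (a ⊗ b) = da ⊗ b + (-1)^|a| a ⊗ db`. -/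
def tensorD : TensorCarrier A B →ₗ[ℚ] TensorCarrier A B :=
  (GradedTensorProduct.of ℚ A.deg B.deg).toLinearMap ∘ₗ
    (TensorProduct.map A.d LinearMap.id + TensorProduct.map A.sign B.d) ∘ₗ
    (GradedTensorProduct.of ℚ A.deg B.deg).symm.toLinearMap

variable {A B}

theorem pure_mem {i j n : ℕ} (h : i + j = n) {a : A} (ha : a ∈ A.deg i) {b : B}
    (hb : b ∈ B.deg j) : pure A B a b ∈ tensorDeg A B n :=
  Submodule.subset_span ⟨i, j, h, a, ha, b, hb, rfl⟩

theorem pure_add_left (a a' : A) (b : B) : pure A B (a + a') b = pure A B a b + pure A B a' b :=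
  congrArg (GradedTensorProduct.of ℚ A.deg B.deg) (TensorProduct.add_tmul a a' b)

theorem pure_add_right (a : A) (b b' : B) : pure A B a (b + b') = pure A B a b + pure A B a b' :=
  congrArg (GradedTensorProduct.of ℚ A.deg B.deg) (TensorProduct.tmul_add a b b')

theorem pure_smul_left (c : ℚ) (a : A) (b : B) : pure A B (c • a) b = c • pure A B a b :=
  rfl

theorem pure_smul_right (c : ℚ) (a : A) (b : B) : pure A B a (c • b) = c • pure A B a b :=
  congrArg (GradedTensorProduct.of ℚ A.deg B.deg) (TensorProduct.tmul_smul c a b)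

theorem tensorD_pure (a : A) (b : B) :
    tensorD A B (pure A B a b) = pure A B (A.d a) b + pure A B (A.sign a) (B.d b) := by
  simp [tensorD, pure]

theorem tensorD_pure_of_mem {i : ℕ} {a : A} (ha : a ∈ A.deg i) (b : B) :
    tensorD A B (pure A B a b) =
      pure A B (A.d a) b + (-1 : ℚ) ^ i • pure A B a (B.d b) := by
  rw [tensorD_pure, sign_of_mem A ha, pure_smul_left]

theorem pure_mul_pure {i j : ℕ} (a : A) {b : B} (hb : b ∈ B.deg j) {a' : A} (ha : a' ∈ A.deg i)
    (b' : B) :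
    pure A B a b * pure A B a' b' = (-1 : ℚ) ^ (j * i) • pure A B (a * a') (b * b') := by
  have := GradedTensorProduct.tmul_coe_mul_coe_tmul (R := ℚ) A.deg B.deg a ⟨b, hb⟩ ⟨a', ha⟩ b'
  refine this.trans ?_
  rw [Units.smul_def, ← Int.cast_smul_eq_zsmul ℚ]
  congr 1
  push_cast
  rfl

theorem tensor_lin_ext {N : Type*} [AddCommMonoid N] [Module ℚ N]
    {f g : TensorCarrier A B →ₗ[ℚ] N}
    (h : ∀ i, ∀ a ∈ A.deg i, ∀ j, ∀ b ∈ B.deg j, f (pure A B a b) = g (pure A B a b)) :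
    f = g := by
  apply GradedTensorProduct.hom_ext
  apply TensorProduct.ext
  refine lin_ext A fun i a ha => ?_
  refine lin_ext B fun j b hb => ?_
  exact h i a ha j b hb

variable (A B)

/-- The decomposition of `A ⊗ B` into homogeneous components. -/
def tensorDecompose : TensorCarrier A B →ₗ[ℚ] ⨁ n, tensorDeg A B n :=
  DirectSum.toModule ℚ (ℕ × ℕ) _ (fun p =>
      DirectSum.lof ℚ ℕ (fun n => tensorDeg A B n) (p.1 + p.2) ∘ₗ
        LinearMap.codRestrict (tensorDeg A B (p.1 + p.2))
          ((GradedTensorProduct.of ℚ A.deg B.deg).toLinearMap ∘ₗ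
            TensorProduct.map (A.deg p.1).subtype (B.deg p.2).subtype)
          (fun x => by
            induction x with
            | zero => simp
            | add x y hx hy => rw [map_add]; exact add_mem hx hy
            | tmul a b => exact pure_mem rfl a.2 b.2)) ∘ₗ
    (TensorProduct.directSum ℚ ℚ (fun i => A.deg i) (fun j => B.deg j)).toLinearMap ∘ₗ
    (GradedTensorProduct.auxEquiv ℚ A.deg B.deg).toLinearMap

variable {A B}

theorem tensorDecompose_pure {i j n : ℕ} (h : i + j = n) {a : A} (ha : a ∈ A.deg i) {b : B}
    (hb : b ∈ B.deg j) :
    tensorDecompose A B (pure A B a b) =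
      DirectSum.lof ℚ ℕ (fun n => tensorDeg A B n) n ⟨pure A B a b, pure_mem h ha hb⟩ := by
  subst h
  have h1 : GradedTensorProduct.auxEquiv ℚ A.deg B.deg (pure A B a b) =
      DirectSum.lof ℚ ℕ (fun i => A.deg i) i ⟨a, ha⟩ ⊗ₜ
        DirectSum.lof ℚ ℕ (fun i => B.deg i) j ⟨b, hb⟩ := by
    rw [pure, GradedTensorProduct.auxEquiv_tmul]
    congr 1
    · exact DirectSum.decompose_coe A.deg ⟨a, ha⟩
    · exact DirectSum.decompose_coe B.deg ⟨b, hb⟩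
  simp only [tensorDecompose, LinearMap.comp_apply, LinearEquiv.coe_coe, h1]
  rw [TensorProduct.directSum_lof_tmul_lof, DirectSum.toModule_lof]
  rfl

theorem tensorDecompose_of_mem {n : ℕ} {x : TensorCarrier A B} (hx : x ∈ tensorDeg A B n) :
    tensorDecompose A B x = DirectSum.lof ℚ ℕ (fun n => tensorDeg A B n) n ⟨x, hx⟩ := by
  induction hx using Submodule.span_induction with
  | mem x h =>
    obtain ⟨i, j, hij, a, ha, b, hb, rfl⟩ := h
    exact tensorDecompose_pure hij ha hb
  | zero => rw [map_zero]; exact (map_zero (DirectSum.lof ℚ ℕ (fun n => tensorDeg A B n) n)).symm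
  | add x y hx hy h1 h2 => rw [map_add, h1, h2]; exact ((DirectSum.lof ℚ ℕ (fun n => tensorDeg A B n) n).map_add _ _).symm
  | smul c x hx h => rw [map_smul, h]; exact ((DirectSum.lof ℚ ℕ (fun n => tensorDeg A B n) n).map_smul c _).symm

instance tensorDecomposition : DirectSum.Decomposition (tensorDeg A B) :=
  DirectSum.Decomposition.ofLinearMap _ (tensorDecompose A B)
    (tensor_lin_ext fun i a ha j b hb => by
      rw [LinearMap.comp_apply, tensorDecompose_pure rfl ha hb]
      exact DirectSum.coeLinearMap_lof (tensorDeg A B) _ _)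
    (DirectSum.linearMap_ext _ fun n => LinearMap.ext fun x => by
      simp only [LinearMap.comp_apply, DirectSum.coeLinearMap_lof, LinearMap.id_apply]
      exact tensorDecompose_of_mem x.2)

theorem tensor_mul_mem {m n : ℕ} {x y : TensorCarrier A B} (hx : x ∈ tensorDeg A B m)
    (hy : y ∈ tensorDeg A B n) : x * y ∈ tensorDeg A B (m + n) := by
  induction hx using Submodule.span_induction with
  | zero => rw [zero_mul]; exact zero_mem _
  | add x x' _ _ h1 h2 => rw [add_mul]; exact add_mem h1 h2
  | smul c x _ h => rw [smul_mul_assoc]; exact Submodule.smul_mem _ _ h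
  | mem x h =>
    obtain ⟨i, j, rfl, a, ha, b, hb, rfl⟩ := h
    induction hy using Submodule.span_induction with
    | zero => rw [mul_zero]; exact zero_mem _
    | add x x' _ _ h1 h2 => rw [mul_add]; exact add_mem h1 h2
    | smul c x _ h => rw [mul_smul_comm]; exact Submodule.smul_mem _ _ h
    | mem x h =>
      obtain ⟨i', j', rfl, a', ha', b', hb', rfl⟩ := h
      rw [pure_mul_pure a hb ha' b']
      refine Submodule.smul_mem _ _ (pure_mem (by omega) (SetLike.mul_mem_graded ha ha')
        (SetLike.mul_mem_graded hb hb'))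

instance tensorGradedAlgebra : GradedAlgebra (tensorDeg A B) where
  one_mem := pure_mem (add_zero 0) SetLike.GradedOne.one_mem SetLike.GradedOne.one_mem
  mul_mem _ _ _ _ hx hy := tensor_mul_mem hx hy

variable (A B)

/-- The tensor product of two CDGAs. -/
def tensor : CDGA.{max u v} where
  carrier := TensorCarrier A B
  deg := tensorDeg A B
  d := tensorD A B
  d_mem {n x} hx := by
    induction hx using Submodule.span_induction with
    | zero => rw [map_zero]; exact zero_mem _
    | add x x' _ _ h1 h2 => rw [map_add]; exact add_mem h1 h2
    | smul c x _ h => rw [map_smul]; exact Submodule.smul_mem _ _ h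
    | mem x h =>
      obtain ⟨i, j, rfl, a, ha, b, hb, rfl⟩ := h
      rw [tensorD_pure_of_mem ha]
      exact add_mem (pure_mem (by omega) (A.d_mem ha) hb)
        (Submodule.smul_mem _ _ (pure_mem (by omega) ha (B.d_mem hb)))
  d_d x := by
    have : tensorD A B ∘ₗ tensorD A B = 0 := tensor_lin_ext fun i a ha j b hb => by
      simp only [LinearMap.comp_apply, tensorD_pure_of_mem ha, map_add, map_smul,
        tensorD_pure_of_mem (A.d_mem ha), A.d_d, B.d_d]
      simp [pure, GradedTensorProduct.tmul, pow_succ]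
    exact LinearMap.congr_fun this x
  leibniz {n x} hx y := by
    induction hx using Submodule.span_induction with
    | zero => simp
    | add x x' _ _ h1 h2 => simp only [add_mul, map_add, h1, h2, smul_add]; abel
    | smul c x _ h => simp only [smul_mul_assoc, map_smul, h, smul_add, smul_comm c]
    | mem x h =>
      obtain ⟨i, j, rfl, a, ha, b, hb, rfl⟩ := h
      have : tensorD A B ∘ₗ LinearMap.mulLeft ℚ (pure A B a b) =
          LinearMap.mulLeft ℚ (tensorD A B (pure A B a b)) +
            (-1 : ℚ) ^ (i + j) • (LinearMap.mulLeft ℚ (pure A B a b) ∘ₗ tensorD A B) :=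
        tensor_lin_ext fun i' a' ha' j' b' hb' => by
          simp only [LinearMap.comp_apply, LinearMap.mulLeft_apply, LinearMap.add_apply,
            LinearMap.smul_apply, tensorD_pure_of_mem ha, tensorD_pure_of_mem ha', add_mul,
            mul_add, smul_mul_assoc, mul_smul_comm,
            pure_mul_pure _ hb ha', pure_mul_pure _ hb (A.d_mem ha'),
            pure_mul_pure _ (B.d_mem hb) ha', map_smul,
            tensorD_pure_of_mem (SetLike.mul_mem_graded ha ha'), A.leibniz ha, B.leibniz hb]
          simp only [pure_add_left, pure_add_right, pure_smul_left, pure_smul_right, smul_add,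
            smul_smul]
          have e3 : (-1 : ℚ) ^ j * (-1) ^ j = 1 := by rw [← mul_pow]; simp
          simp only [pow_add, mul_one, one_mul]
          have c1 : (-1 : ℚ) ^ i * (-1) ^ j * ((-1) ^ (j * i') * (-1) ^ j) =
              (-1) ^ (j * i') * (-1) ^ i := by
            linear_combination ((-1 : ℚ) ^ i * (-1) ^ (j * i')) * e3
          rw [c1]
          module
      exact LinearMap.congr_fun this y
  graded_comm {m n x y} hx hy := by
    induction hx using Submodule.span_induction with
    | zero => simp
    | add x x' _ _ h1 h2 => simp only [add_mul, mul_add, h1, h2, smul_add]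
    | smul c x _ h => rw [smul_mul_assoc, h, mul_smul_comm, smul_comm]
    | mem x h =>
      obtain ⟨i, j, rfl, a, ha, b, hb, rfl⟩ := h
      induction hy using Submodule.span_induction with
      | zero => simp
      | add x x' _ _ h1 h2 => simp only [add_mul, mul_add, h1, h2, smul_add]
      | smul c x _ h => rw [mul_smul_comm, h, smul_mul_assoc, smul_comm]
      | mem x h =>
        obtain ⟨i', j', rfl, a', ha', b', hb', rfl⟩ := h
        rw [pure_mul_pure _ hb ha', pure_mul_pure _ hb' ha, A.graded_comm ha ha',
          B.graded_comm hb hb']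
        simp only [pure_smul_left, pure_smul_right, smul_smul]
        congr 1
        have e1 : (-1 : ℚ) ^ (j' * i) * (-1) ^ (j' * i) = 1 := by rw [← mul_pow]; simp
        have e2 : (-1 : ℚ) ^ ((i + j) * (i' + j')) =
            (-1) ^ (i * i') * (-1) ^ (j * j') * (-1) ^ (j * i') * (-1) ^ (j' * i) := by ring
        rw [e2]
        linear_combination (-(-1 : ℚ) ^ (i * i') * (-1) ^ (j * j') * (-1) ^ (j * i')) * e1

end Tensor

/-! ### Polynomial forms on the interval and homotopies -/

section Interval

/-- The underlying algebra of `Λ(t, dt)`: the square-zero extension `ℚ[t] ⊕ ℚ[t] dt`. -/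
abbrev IntervalCarrier : Type := TrivSqZeroExt ℚ[X] ℚ[X]

/-- `ℚ[t]` in degree `0` and `ℚ[t] dt` in degree `1`. -/
def intervalDeg : ℕ → Submodule ℚ IntervalCarrier
  | 0 => LinearMap.ker ((TrivSqZeroExt.sndHom ℚ[X] ℚ[X]).restrictScalars ℚ)
  | 1 => LinearMap.ker (TrivSqZeroExt.fstHom ℚ ℚ[X] ℚ[X]).toLinearMap
  | _ => ⊥

/-- `d (p + q dt) = p' dt`. -/
def intervalD : IntervalCarrier →ₗ[ℚ] IntervalCarrier :=
  (TrivSqZeroExt.inrHom ℚ[X] ℚ[X]).restrictScalars ℚ ∘ₗ Polynomial.derivative ∘ₗ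
    (TrivSqZeroExt.fstHom ℚ ℚ[X] ℚ[X]).toLinearMap

theorem mem_intervalDeg_zero {x : IntervalCarrier} : x ∈ intervalDeg 0 ↔ x.snd = 0 := Iff.rfl

theorem mem_intervalDeg_one {x : IntervalCarrier} : x ∈ intervalDeg 1 ↔ x.fst = 0 := Iff.rfl

theorem mem_intervalDeg_add_two {n : ℕ} {x : IntervalCarrier} :
    x ∈ intervalDeg (n + 2) ↔ x = 0 := Iff.rfl

@[simp] theorem intervalD_apply (x : IntervalCarrier) :
    intervalD x = TrivSqZeroExt.inr (Polynomial.derivative x.fst) := rfl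

theorem interval_mul_mem {i j : ℕ} {x y : IntervalCarrier} (hx : x ∈ intervalDeg i)
    (hy : y ∈ intervalDeg j) : x * y ∈ intervalDeg (i + j) := by
  match i, j with
  | 0, 0 =>
    rw [mem_intervalDeg_zero] at *
    simp [hx, hy]
  | 0, 1 =>
    rw [mem_intervalDeg_one] at *
    simp [hy]
  | 1, 0 =>
    rw [mem_intervalDeg_one] at *
    simp [hx]
  | 1, 1 =>
    rw [mem_intervalDeg_one] at *
    refine mem_intervalDeg_add_two.2 (TrivSqZeroExt.ext ?_ ?_) <;> simp [hx, hy]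
  | i + 2, j =>
    rw [mem_intervalDeg_add_two.1 hx, zero_mul]
    exact zero_mem _
  | i, j + 2 =>
    rw [mem_intervalDeg_add_two.1 hy, mul_zero]
    exact zero_mem _

/-- The decomposition of `p + q dt` into `p` and `q dt`. -/
def intervalDecompose : IntervalCarrier →ₗ[ℚ] ⨁ n, intervalDeg n :=
  DirectSum.lof ℚ ℕ (fun n => intervalDeg n) 0 ∘ₗ
      LinearMap.codRestrict (intervalDeg 0)
        ((TrivSqZeroExt.inlAlgHom ℚ ℚ[X] ℚ[X]).toLinearMap ∘ₗ
          (TrivSqZeroExt.fstHom ℚ ℚ[X] ℚ[X]).toLinearMap)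
        (fun _ => mem_intervalDeg_zero.2 (TrivSqZeroExt.snd_inl _ _)) +
    DirectSum.lof ℚ ℕ (fun n => intervalDeg n) 1 ∘ₗ
      LinearMap.codRestrict (intervalDeg 1)
        ((TrivSqZeroExt.inrHom ℚ[X] ℚ[X]).restrictScalars ℚ ∘ₗ
          (TrivSqZeroExt.sndHom ℚ[X] ℚ[X]).restrictScalars ℚ)
        (fun _ => mem_intervalDeg_one.2 (TrivSqZeroExt.fst_inr _ _))

theorem intervalDecompose_apply (x : IntervalCarrier) :
    intervalDecompose x =
      DirectSum.lof ℚ ℕ (fun n => intervalDeg n) 0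
        ⟨TrivSqZeroExt.inl x.fst, mem_intervalDeg_zero.2 (TrivSqZeroExt.snd_inl _ _)⟩ +
      DirectSum.lof ℚ ℕ (fun n => intervalDeg n) 1
        ⟨TrivSqZeroExt.inr x.snd, mem_intervalDeg_one.2 (TrivSqZeroExt.fst_inr _ _)⟩ := rfl

theorem intervalDecompose_of_mem {n : ℕ} {x : IntervalCarrier} (hx : x ∈ intervalDeg n) :
    intervalDecompose x = DirectSum.lof ℚ ℕ (fun n => intervalDeg n) n ⟨x, hx⟩ := by
  rw [intervalDecompose_apply]
  match n with
  | 0 =>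
    have h : x.snd = 0 := hx
    have e1 : (⟨TrivSqZeroExt.inl x.fst, mem_intervalDeg_zero.2 (TrivSqZeroExt.snd_inl _ _)⟩ :
        intervalDeg 0) = ⟨x, hx⟩ := Subtype.ext (TrivSqZeroExt.ext (by simp) (by simp [h]))
    have e2 : (⟨TrivSqZeroExt.inr x.snd, mem_intervalDeg_one.2 (TrivSqZeroExt.fst_inr _ _)⟩ :
        intervalDeg 1) = 0 := Subtype.ext (TrivSqZeroExt.ext (by simp) (by simp [h]))
    rw [e1, e2, map_zero, add_zero]
  | 1 =>
    have h : x.fst = 0 := hx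
    have e1 : (⟨TrivSqZeroExt.inl x.fst, mem_intervalDeg_zero.2 (TrivSqZeroExt.snd_inl _ _)⟩ :
        intervalDeg 0) = 0 := Subtype.ext (TrivSqZeroExt.ext (by simp [h]) (by simp))
    have e2 : (⟨TrivSqZeroExt.inr x.snd, mem_intervalDeg_one.2 (TrivSqZeroExt.fst_inr _ _)⟩ :
        intervalDeg 1) = ⟨x, hx⟩ := Subtype.ext (TrivSqZeroExt.ext (by simp [h]) (by simp))
    rw [e1, e2, map_zero, zero_add]
  | n + 2 =>
    obtain rfl : x = 0 := hx
    have e1 : (⟨TrivSqZeroExt.inl (0 : IntervalCarrier).fst,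
        mem_intervalDeg_zero.2 (TrivSqZeroExt.snd_inl _ _)⟩ :
        intervalDeg 0) = 0 := Subtype.ext (TrivSqZeroExt.ext (by simp) (by simp))
    have e2 : (⟨TrivSqZeroExt.inr (0 : IntervalCarrier).snd,
        mem_intervalDeg_one.2 (TrivSqZeroExt.fst_inr _ _)⟩ :
        intervalDeg 1) = 0 := Subtype.ext (TrivSqZeroExt.ext (by simp) (by simp))
    rw [e1, e2, map_zero, map_zero, add_zero]
    exact (map_zero (DirectSum.lof ℚ ℕ (fun n => intervalDeg n) (n + 2))).symm

instance intervalDecomposition : DirectSum.Decomposition intervalDeg :=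
  DirectSum.Decomposition.ofLinearMap _ intervalDecompose
    (LinearMap.ext fun x => by
      rw [LinearMap.comp_apply, intervalDecompose_apply, map_add,
        DirectSum.coeLinearMap_lof intervalDeg, DirectSum.coeLinearMap_lof intervalDeg]
      exact TrivSqZeroExt.inl_fst_add_inr_snd_eq x)
    (DirectSum.linearMap_ext _ fun n => LinearMap.ext fun x => by
      simp only [LinearMap.comp_apply, DirectSum.coeLinearMap_lof, LinearMap.id_apply]
      exact intervalDecompose_of_mem x.2)

instance intervalGradedAlgebra : GradedAlgebra intervalDeg where
  one_mem := mem_intervalDeg_zero.2 TrivSqZeroExt.snd_one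
  mul_mem _ _ _ _ hx hy := interval_mul_mem hx hy

/-- The CDGA `Λ(t, dt)` of polynomial differential forms on the interval. -/
def interval : CDGA.{0} where
  carrier := IntervalCarrier
  deg := intervalDeg
  d := intervalD
  d_mem {n x} hx := by
    match n with
    | 0 => exact mem_intervalDeg_one.2 (TrivSqZeroExt.fst_inr _ _)
    | n + 1 =>
      have h : x.fst = 0 := by
        match n with
        | 0 => exact hx
        | n + 1 => rw [mem_intervalDeg_add_two.1 hx]; rfl
      rw [intervalD_apply, h]
      simp
  d_d x := by simp
  leibniz {n x} hx y := by
    match n with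
    | 0 =>
      have h : x.snd = 0 := hx
      refine TrivSqZeroExt.ext ?_ ?_
      · simp
      · simp
        ring
    | 1 =>
      have h : x.fst = 0 := hx
      refine TrivSqZeroExt.ext ?_ ?_ <;> simp [h]
    | n + 2 =>
      rw [mem_intervalDeg_add_two.1 hx]
      simp
  graded_comm {i j x y} hx hy := by
    match i, j with
    | 0, j => simp [mul_comm]
    | i, 0 => simp [mul_comm]
    | 1, 1 =>
      have h : x.fst = 0 := hx
      have h' : y.fst = 0 := hy
      refine TrivSqZeroExt.ext ?_ ?_ <;> simp [h, h']
    | i + 2, j => rw [mem_intervalDeg_add_two.1 hx]; simp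
    | i, j + 2 => rw [mem_intervalDeg_add_two.1 hy]; simp

/-- The augmentation `p + q dt ↦ p(c)` of `Λ(t, dt)`; `ε₀` and `ε₁` are the cases `c = 0, 1`. -/
def intervalEval (c : ℚ) : interval →ₗ[ℚ] ℚ :=
  (Polynomial.aeval c).toLinearMap ∘ₗ (TrivSqZeroExt.fstHom ℚ ℚ[X] ℚ[X]).toLinearMap

/-- The integral `p + q dt ↦ ∫₀¹ q dt`, i.e. `t ^ k ↦ 0` and `t ^ k dt ↦ 1 / (k + 1)`. -/
def intervalIntegral : interval →ₗ[ℚ] ℚ :=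
  Polynomial.lsum (fun k : ℕ => (1 / ((k : ℚ) + 1)) • (LinearMap.id : ℚ →ₗ[ℚ] ℚ)) ∘ₗ
    (TrivSqZeroExt.sndHom ℚ[X] ℚ[X]).restrictScalars ℚ

theorem intervalIntegral_d (x : interval) :
    intervalIntegral (interval.d x) = intervalEval 1 x - intervalEval 0 x := by
  have h : ∀ p : ℚ[X],
      Polynomial.lsum (fun k : ℕ => (1 / ((k : ℚ) + 1)) • (LinearMap.id : ℚ →ₗ[ℚ] ℚ))
        (Polynomial.derivative p) = Polynomial.aeval (1 : ℚ) p - Polynomial.aeval (0 : ℚ) p := by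
    intro p
    induction p using Polynomial.induction_on' with
    | add p q hp hq => simp only [map_add, hp, hq]; ring
    | monomial n a =>
      rw [Polynomial.derivative_monomial, Polynomial.lsum_apply,
        Polynomial.sum_monomial_index _ _ (by simp)]
      cases n with
      | zero => simp
      | succ n =>
        have : (n : ℚ) + 1 ≠ 0 := by positivity
        simp
        field_simp
  exact h x.fst

variable {B : CDGA.{v}}

/-- The map `B ⊗ Λ(t, dt) → B`, `b ⊗ ω ↦ ℓ(ω) s(b)`. -/
def contract (s : B →ₗ[ℚ] B) (l : interval →ₗ[ℚ] ℚ) :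
    TensorCarrier B interval →ₗ[ℚ] B :=
  (TensorProduct.rid ℚ B).toLinearMap ∘ₗ TensorProduct.map s l ∘ₗ
    (GradedTensorProduct.of ℚ B.deg interval.deg).symm.toLinearMap

theorem contract_pure (s : B →ₗ[ℚ] B) (l : interval →ₗ[ℚ] ℚ) (b : B) (x : interval) :
    contract s l (pure B interval b x) = l x • s b := by
  change TensorProduct.rid ℚ B (TensorProduct.map s l (b ⊗ₜ x)) = _
  simp

/-- The restriction `id · ε_c : B ⊗ Λ(t, dt) → B` to `t = c`, i.e. `b ⊗ ω ↦ ε_c(ω) b`. -/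
def evalAt (B : CDGA.{v}) (c : ℚ) : tensor B interval →ₗ[ℚ] B :=
  contract LinearMap.id (intervalEval c)

/-- Integration along the interval `id ⊗ ∫₀¹ : B ⊗ Λ(t, dt) → B`. As `∫₀¹` has degree `-1`, the
usual sign rule gives `b ⊗ ω ↦ (-1)^|b| (∫₀¹ ω) b`. -/
def fiberIntegral (B : CDGA.{v}) : tensor B interval →ₗ[ℚ] B :=
  contract B.sign intervalIntegral

theorem fiberIntegral_stokes (x : tensor B interval) :
    B.d (fiberIntegral B x) + fiberIntegral B ((tensor B interval).d x) =
      evalAt B 1 x - evalAt B 0 x := by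
  have : B.d ∘ₗ contract B.sign intervalIntegral +
      contract B.sign intervalIntegral ∘ₗ tensorD B interval =
      contract LinearMap.id (intervalEval 1) - contract LinearMap.id (intervalEval 0) := tensor_lin_ext fun i b hb j y hy => by
    simp only [LinearMap.add_apply, LinearMap.sub_apply, LinearMap.comp_apply,
      tensorD_pure_of_mem hb, map_add, map_smul, contract_pure, sign_of_mem B hb,
      sign_of_mem B (B.d_mem hb), intervalIntegral_d, LinearMap.id_apply]
    have e : (-1 : ℚ) ^ i * (-1) ^ i = 1 := by rw [← mul_pow]; simp
    have e' : (-1 : ℚ) ^ i • (intervalEval 1 y - intervalEval 0 y) • (-1 : ℚ) ^ i • b =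
        (intervalEval 1 y - intervalEval 0 y) • b := by
      rw [smul_smul, smul_smul]
      congr 1
      linear_combination (intervalEval 1 y - intervalEval 0 y) * e
    rw [e', pow_succ]
    module
  exact LinearMap.congr_fun this x

theorem fiberIntegral_mem {n : ℕ} {x : tensor B interval}
    (hx : x ∈ (tensor B interval).deg (n + 1)) : fiberIntegral B x ∈ B.deg n := by
  induction hx using Submodule.span_induction with
  | zero => rw [map_zero]; exact zero_mem _
  | add x x' _ _ h1 h2 => rw [map_add]; exact add_mem h1 h2
  | smul c x _ h => rw [map_smul]; exact Submodule.smul_mem _ _ h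
  | mem x h =>
    obtain ⟨i, j, hij, b, hb, y, hy, rfl⟩ := h
    change contract B.sign intervalIntegral (pure B interval b y) ∈ B.deg n
    rw [contract_pure, sign_of_mem B hb]
    match j with
    | 0 =>
      have h0 : intervalIntegral y = 0 := by
        have h : TrivSqZeroExt.snd y = 0 := hy
        change Polynomial.lsum _ (TrivSqZeroExt.snd y) = 0
        rw [h, map_zero]
      rw [h0, zero_smul]
      exact zero_mem _
    | 1 =>
      obtain rfl : i = n := by omega
      exact Submodule.smul_mem _ _ (Submodule.smul_mem _ _ hb)
    | j + 2 =>
      have h0 : y = 0 := hy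
      rw [h0, map_zero, zero_smul]
      exact zero_mem _

/-- A homotopy from `f` to `g`: a CDGA map `H : A → B ⊗ Λ(t, dt)` with `(id · ε₀) H = f` and
`(id · ε₁) H = g`. -/
structure Homotopy {A : CDGA.{u}} {B : CDGA.{v}} (f g : Hom A B) where
  toHom : Hom A (tensor B interval)
  eval_zero : ∀ a, evalAt B 0 (toHom a) = f a
  eval_one : ∀ a, evalAt B 1 (toHom a) = g a

/-- The cochain homotopy `∫₀¹ H` underlying a homotopy `H`. -/
def Homotopy.integral {A : CDGA.{u}} {B : CDGA.{v}} {f g : Hom A B} (H : Homotopy f g) :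
    A →ₗ[ℚ] B :=
  fiberIntegral B ∘ₗ H.toHom.lin

theorem Homotopy.d_integral {A : CDGA.{u}} {B : CDGA.{v}} {f g : Hom A B} (H : Homotopy f g)
    (a : A) : B.d (H.integral a) + H.integral (A.d a) = g a - f a := by
  have := fiberIntegral_stokes (H.toHom a)
  rw [← H.toHom.map_d, H.eval_zero, H.eval_one] at this
  exact this

end Interval

/-! ### Cohomology and cones -/

section Cohomology

variable {E : Type u} [AddCommGroup E] [Module ℚ E] {E' : Type v} [AddCommGroup E'] [Module ℚ E']

/-- The cocycles of `D` lying in the homogeneous part `G`. -/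
abbrev cocyclesIn (G : Submodule ℚ E) (D : E →ₗ[ℚ] E) : Submodule ℚ E := G ⊓ LinearMap.ker D

/-- The cohomology in the degree whose homogeneous part is `G`: cocycles in `G` modulo
coboundaries. As `D` is homogeneous, an element of `G` that is a coboundary is the coboundary
of an element of the preceding degree (`mem_range_d_iff`, `mem_range_coneD_iff`). -/
abbrev CohomologyIn (G : Submodule ℚ E) (D : E →ₗ[ℚ] E) : Type u :=
  ↥(cocyclesIn G D) ⧸ (LinearMap.range D).submoduleOf (cocyclesIn G D)

/-- The map induced on cohomology by a degree-preserving cochain map. -/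
def cohomologyInMap {G : Submodule ℚ E} {D : E →ₗ[ℚ] E} {G' : Submodule ℚ E'}
    {D' : E' →ₗ[ℚ] E'} (F : E →ₗ[ℚ] E') (hG : ∀ x ∈ G, F x ∈ G')
    (hD : ∀ x, F (D x) = D' (F x)) : CohomologyIn G D →ₗ[ℚ] CohomologyIn G' D' :=
  Submodule.mapQ _ _
    (F.restrict (p := cocyclesIn G D) (q := cocyclesIn G' D') fun x hx =>
      ⟨hG x hx.1, by
        have h : D x = 0 := hx.2
        change D' (F x) = 0
        rw [← hD, h, map_zero]⟩)
    (by
      rintro ⟨x, hx⟩ ⟨y, hy⟩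
      exact ⟨F y, by rw [← hD, hy]; rfl⟩)

/-- `Hⁿ(A)`. -/
abbrev Cohomology (A : CDGA.{u}) (n : ℕ) : Type u := CohomologyIn (A.deg n) A.d

/-- `Hⁿ(f)`. -/
def Hom.cohomologyMap {A : CDGA.{u}} {B : CDGA.{v}} (f : Hom A B) (n : ℕ) :
    A.Cohomology n →ₗ[ℚ] B.Cohomology n :=
  cohomologyInMap f.lin (fun _ hx => f.map_deg hx) f.map_d

theorem decompose_d (A : CDGA.{u}) (a : A) (n : ℕ) :
    (DirectSum.decompose A.deg (A.d a) (n + 1) : A) = A.d (DirectSum.decompose A.deg a n) := by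
  induction a using DirectSum.Decomposition.inductionOn A.deg with
  | zero => simp
  | add x y hx hy => simp [hx, hy]
  | homogeneous x =>
    rename_i i
    by_cases h : i = n
    · subst h
      rw [DirectSum.decompose_of_mem_same _ (A.d_mem x.2), DirectSum.decompose_of_mem_same _ x.2]
    · rw [DirectSum.decompose_of_mem_ne _ (A.d_mem x.2) (by omega),
        DirectSum.decompose_of_mem_ne _ x.2 h, map_zero]

theorem decompose_hom {A : CDGA.{u}} {B : CDGA.{v}} (f : Hom A B) (a : A) (n : ℕ) :
    (DirectSum.decompose B.deg (f a) n : B) = f (DirectSum.decompose A.deg a n) := by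
  induction a using DirectSum.Decomposition.inductionOn A.deg with
  | zero => simp
  | add x y hx hy => simp [hx, hy]
  | homogeneous x =>
    rename_i i
    by_cases h : i = n
    · subst h
      rw [DirectSum.decompose_of_mem_same _ (f.map_deg x.2),
        DirectSum.decompose_of_mem_same _ x.2]
    · rw [DirectSum.decompose_of_mem_ne _ (f.map_deg x.2) h,
        DirectSum.decompose_of_mem_ne _ x.2 h, map_zero]

theorem mem_range_d_iff (A : CDGA.{u}) {n : ℕ} {a : A} (ha : a ∈ A.deg (n + 1)) :
    a ∈ LinearMap.range A.d ↔ ∃ b ∈ A.deg n, A.d b = a := by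
  constructor
  · rintro ⟨b, rfl⟩
    refine ⟨DirectSum.decompose A.deg b n, SetLike.coe_mem _, ?_⟩
    rw [← decompose_d, DirectSum.decompose_of_mem_same _ ha]
  · rintro ⟨b, -, rfl⟩
    exact ⟨b, rfl⟩

/-- `A` is connected: the unit `ℚ → H⁰(A)` is an isomorphism. -/
def IsConnected (A : CDGA.{u}) : Prop :=
  ∀ a ∈ A.deg 0, A.d a = 0 → ∃! q : ℚ, algebraMap ℚ A q = a

/-- `A` is simply-connected: it is connected and `H¹(A) = 0`. -/
def IsSimplyConnected (A : CDGA.{u}) : Prop :=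
  A.IsConnected ∧ Subsingleton (A.Cohomology 1)

/-- Quasi-isomorphisms: maps inducing isomorphisms on cohomology. -/
def Hom.IsQuasiIso {A : CDGA.{u}} {B : CDGA.{v}} (f : Hom A B) : Prop :=
  ∀ n, Function.Bijective (f.cohomologyMap n)

variable {A : CDGA.{u}} {B : CDGA.{v}}

/-- The degree `n` part `A^(n+1) ⊕ Bⁿ` of the cochain mapping cone `C_f` of `f : A → B`. -/
def coneDeg (_f : Hom A B) (n : ℕ) : Submodule ℚ (A × B) := (A.deg (n + 1)).prod (B.deg n)

/-- The differential `d (a, b) = (da, f(a) - db)` of the mapping cone `C_f`. -/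
def coneD (f : Hom A B) : A × B →ₗ[ℚ] A × B :=
  LinearMap.prod (A.d ∘ₗ LinearMap.fst ℚ A B)
    (f.lin ∘ₗ LinearMap.fst ℚ A B - B.d ∘ₗ LinearMap.snd ℚ A B)

theorem coneD_apply (f : Hom A B) (x : A × B) : coneD f x = (A.d x.1, f x.1 - B.d x.2) := rfl

theorem coneD_coneD (f : Hom A B) (x : A × B) : coneD f (coneD f x) = 0 := by
  simp [coneD_apply, A.d_d, B.d_d, f.map_d]

theorem mem_range_coneD_iff (f : Hom A B) {n : ℕ} {x : A × B} (hx : x ∈ coneDeg f (n + 1)) :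
    x ∈ LinearMap.range (coneD f) ↔ ∃ y ∈ coneDeg f n, coneD f y = x := by
  constructor
  · rintro ⟨y, rfl⟩
    refine ⟨(DirectSum.decompose A.deg y.1 (n + 1), DirectSum.decompose B.deg y.2 n),
      ⟨SetLike.coe_mem _, SetLike.coe_mem _⟩, ?_⟩
    rw [coneD_apply, coneD_apply]
    have h1 : A.d y.1 ∈ A.deg (n + 2) := hx.1
    have h2 : f y.1 - B.d y.2 ∈ B.deg (n + 1) := hx.2
    ext
    · simp only
      rw [← decompose_d, DirectSum.decompose_of_mem_same _ h1]
    · simp only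
      rw [← decompose_d, ← decompose_hom, ← DirectSum.decompose_of_mem_same _ h2]
      simp
  · rintro ⟨y, -, rfl⟩
    exact ⟨y, rfl⟩

/-- `Zⁿ(C_f)`. -/
abbrev ConeCocycles (f : Hom A B) (n : ℕ) : Submodule ℚ (A × B) :=
  cocyclesIn (coneDeg f n) (coneD f)

/-- `Hⁿ(C_f)`. -/
abbrev ConeCohomology (f : Hom A B) (n : ℕ) : Type (max u v) :=
  CohomologyIn (coneDeg f n) (coneD f)

/-- The class in `Hⁿ(C_f)` of a cocycle. -/
def coneClass (f : Hom A B) (n : ℕ) : ConeCocycles f n →ₗ[ℚ] ConeCohomology f n :=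
  Submodule.mkQ _

end Cohomology

/-! ### Hirsch extensions and minimal algebras -/

/-- `j : A → E` is a Hirsch extension of degree `k` along the vector space `V` with attaching map
`τ : V → Z^(k+1)(A)`; the elements `ι v` are the new generators, of degree `k`, with
`d (ι v) = τ v`. The last clause is the universal property of the pushout of
`Λ S^(k+1)(V) → A` along `Λ S^(k+1)(V) → Λ D^(k+1)(V)`, where a map out of
`Λ S^(k+1)(V)`, respectively `Λ D^(k+1)(V)`, amounts to a linear map from `V` to the cocycles of
degree `k + 1`, respectively to the elements of degree `k`. -/
structure IsHirschExtensionAlong {A E : CDGA.{u}} (j : Hom A E) (k : ℕ) {V : Type u}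
    [AddCommGroup V] [Module ℚ V] (τ : V →ₗ[ℚ] A) (ι : V →ₗ[ℚ] E) : Prop where
  attach_mem : ∀ v, τ v ∈ A.deg (k + 1)
  attach_d : ∀ v, A.d (τ v) = 0
  gen_mem : ∀ v, ι v ∈ E.deg k
  gen_d : ∀ v, E.d (ι v) = j (τ v)
  desc : ∀ (C : CDGA.{u}) (h : Hom A C) (φ : V →ₗ[ℚ] C), (∀ v, φ v ∈ C.deg k) →
    (∀ v, C.d (φ v) = h (τ v)) → ∃! e : Hom E C, e.comp j = h ∧ ∀ v, e (ι v) = φ v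

/-- `j` is a Hirsch extension of degree `k` (along some vector space). -/
def IsHirschExtension {A E : CDGA.{u}} (j : Hom A E) (k : ℕ) : Prop :=
  ∃ (V : Type u) (_ : AddCommGroup V) (_ : Module ℚ V) (τ : V →ₗ[ℚ] A) (ι : V →ₗ[ℚ] E),
    IsHirschExtensionAlong j k τ ι

/-- `A = ℚ`: the unit map is an isomorphism. -/
def IsGroundField (A : CDGA.{u}) : Prop := Function.Bijective (algebraMap ℚ A)

/-- An exhaustive skeletal filtration `ℚ = M₀ ⊆ M₁ ⊆ ⋯ ⊆ ⋃ M_k = M` in which each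
`M_k ⊆ M_(k+1)` is a Hirsch extension of degree `k + 1`. -/
structure SkeletalFiltration (M : CDGA.{u}) where
  stage : ℕ → CDGA.{u}
  step : ∀ k, Hom (stage k) (stage (k + 1))
  incl : ∀ k, Hom (stage k) M
  incl_step : ∀ k, (incl (k + 1)).comp (step k) = incl k
  base : (stage 0).IsGroundField
  hirsch : ∀ k, IsHirschExtension (step k) (k + 1)
  incl_injective : ∀ k, Function.Injective (incl k)
  exhaustive : ∀ x : M, ∃ k, x ∈ Set.range (incl k)

/-- Minimal (Sullivan) algebras. -/
def IsMinimal (M : CDGA.{u}) : Prop := Nonempty (SkeletalFiltration M)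

/-- `k`-minimal algebras: the skeletal filtration terminates at level `k`. -/
def IsKMinimal (M : CDGA.{u}) (k : ℕ) : Prop :=
  ∃ F : SkeletalFiltration M, Function.Surjective (F.incl k)

/-- `m : M → A` is a minimal model of `A`. -/
def Hom.IsMinimalModel {M A : CDGA.{u}} (m : Hom M A) : Prop := M.IsMinimal ∧ m.IsQuasiIso

/-- `m : M → A` is a `k`-minimal model of `A`: `M` is a `k`-minimal algebra, and `m` induces
isomorphisms on cohomology in degrees `≤ k` and an injection in degree `k + 1`. -/
def Hom.IsKMinimalModel {M A : CDGA.{u}} (m : Hom M A) (k : ℕ) : Prop :=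
  M.IsKMinimal k ∧ (∀ i ≤ k, Function.Bijective (m.cohomologyMap i)) ∧
    Function.Injective (m.cohomologyMap (k + 1))

/-- The decomposable elements: the span of the products of two homogeneous elements of positive
degree. The indecomposables `Q(A)` are `A⁺` modulo this subspace. -/
def decomposables (A : CDGA.{u}) : Submodule ℚ A :=
  Submodule.span ℚ {x | ∃ i j : ℕ, 0 < i ∧ 0 < j ∧ ∃ a ∈ A.deg i, ∃ b ∈ A.deg j, x = a * b}

/-- `X`, with the maps `incl n : F n → X`, is the colimit of the sequence
`F 0 → F 1 → F 2 → ⋯` in the category of CDGAs. -/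
def IsSequentialColimit {F : ℕ → CDGA.{u}} (step : ∀ n, Hom (F n) (F (n + 1))) {X : CDGA.{u}}
    (incl : ∀ n, Hom (F n) X) : Prop :=
  (∀ n, (incl (n + 1)).comp (step n) = incl n) ∧
    ∀ (C : CDGA.{u}) (c : ∀ n, Hom (F n) C), (∀ n, (c (n + 1)).comp (step n) = c n) →
      ∃! h : Hom X C, ∀ n, h.comp (incl n) = c n

/-! ### Minimal models of maps -/

section Maps

variable {A B : CDGA.{u}}

/-- A square over `f : A → B` with top map `g : M → N` and vertical maps `m : M → A`,
`n : N → B`, commuting up to a specified homotopy `H` from `f m` to `n g`. -/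
structure MapSquare (f : Hom A B) where
  M : CDGA.{u}
  N : CDGA.{u}
  g : Hom M N
  m : Hom M A
  n : Hom N B
  H : Homotopy (f.comp m) (n.comp g)

namespace MapSquare

variable {f : Hom A B}

/-- The square is a `k`-minimal model of `f`. -/
def IsKMinimalModel (S : MapSquare f) (k : ℕ) : Prop :=
  S.m.IsKMinimalModel k ∧ S.n.IsKMinimalModel k

/-- The square is a minimal model of `f`. -/
def IsMinimalModel (S : MapSquare f) : Prop :=
  S.m.IsMinimalModel ∧ S.n.IsMinimalModel

/-- The cochain map `C_m → C_n` induced on cones, `(a, b) ↦ (g(a), f(b) + ∫₀¹ H(a))`. -/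
def coneMap (S : MapSquare f) : S.M × A →ₗ[ℚ] S.N × B :=
  LinearMap.prod (S.g.lin ∘ₗ LinearMap.fst ℚ S.M A)
    (f.lin ∘ₗ LinearMap.snd ℚ S.M A + S.H.integral ∘ₗ LinearMap.fst ℚ S.M A)

theorem coneMap_apply (S : MapSquare f) (x : S.M × A) :
    S.coneMap x = (S.g x.1, f x.2 + S.H.integral x.1) := rfl

theorem coneMap_mem (S : MapSquare f) (k : ℕ) (x : S.M × A) (hx : x ∈ coneDeg S.m k) :
    S.coneMap x ∈ coneDeg S.n k :=
  ⟨S.g.map_deg hx.1,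
    add_mem (f.map_deg hx.2) (fiberIntegral_mem (S.H.toHom.map_deg hx.1))⟩

theorem coneMap_coneD (S : MapSquare f) (x : S.M × A) :
    S.coneMap (coneD S.m x) = coneD S.n (S.coneMap x) := by
  have h := S.H.d_integral x.1
  simp only [Hom.comp_apply] at h
  simp only [coneMap_apply, coneD_apply, S.g.map_d, map_sub, map_add, f.map_d]
  ext
  · rfl
  · simp only
    rw [eq_sub_iff_add_eq] at h
    rw [← h]
    abel

/-- The map `H^k(C_m) → H^k(C_n)` induced on the cohomology of the cones. -/
def coneCohomologyMap (S : MapSquare f) (k : ℕ) :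
    ConeCohomology S.m k →ₗ[ℚ] ConeCohomology S.n k :=
  cohomologyInMap S.coneMap (S.coneMap_mem k) S.coneMap_coneD

/-- `S'` extends the square `S` by attaching the cohomology of the cones in degree `k`: it
consists of degree `k` Hirsch extensions `M → M⟨H^k C_m⟩` and `N → N⟨H^k C_n⟩`, compatible
with all maps and with the homotopies. -/
structure ConeExtension (k : ℕ) (S S' : MapSquare f) where
  i : Hom S.M S'.M
  j : Hom S.N S'.N
  top_comm : S'.g.comp i = j.comp S.g
  left_comm : S'.m.comp i = S.m
  right_comm : S'.n.comp j = S.n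
  homotopy_comm : S'.H.toHom.comp i = S.H.toHom
  /-- the attaching map and the new generators on the source side -/
  attachM : ConeCohomology S.m k →ₗ[ℚ] S.M
  genM : ConeCohomology S.m k →ₗ[ℚ] S'.M
  hirschM : IsHirschExtensionAlong i k attachM genM
  /-- the generator attached for the class `α` satisfies `α = [(dα, m(α))]` -/
  reprM : ∀ α, ∃ z : ConeCocycles S.m k,
    (z : S.M × A) = (attachM α, S'.m (genM α)) ∧ coneClass S.m k z = α
  /-- the attaching map and the new generators on the target side -/
  attachN : ConeCohomology S.n k →ₗ[ℚ] S.N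
  genN : ConeCohomology S.n k →ₗ[ℚ] S'.N
  hirschN : IsHirschExtensionAlong j k attachN genN
  reprN : ∀ β, ∃ z : ConeCocycles S.n k,
    (z : S.N × B) = (attachN β, S'.n (genN β)) ∧ coneClass S.n k z = β
  /-- on the new generators, the extended map agrees modulo decomposables with the map induced
  on the cohomology of the cones -/
  linear_part : ∀ α, S'.g (genM α) - genN (S.coneCohomologyMap k α) ∈ S'.N.decomposables

end MapSquare

/-- An approximation telescope over `f`: starting from the trivial square `ℚ = ℚ` over `f`, each
square is obtained from the previous one by attaching the cohomology of its cones, in degrees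
`2, 3, 4, …`. The square at index `n` is the one meant to be an `(n + 1)`-minimal model. -/
structure ApproximationTelescope (f : Hom A B) where
  square : ℕ → MapSquare f
  baseM : (square 0).M.IsGroundField
  baseN : (square 0).N.IsGroundField
  ext : ∀ n, MapSquare.ConeExtension (n + 2) (square n) (square (n + 1))

/-- `S` is the colimit of the telescope `T`: its algebras are the colimits of the algebras of `T`,
and its maps and its homotopy are the ones induced on the colimits. -/
structure ApproximationTelescope.Colimit {f : Hom A B} (T : ApproximationTelescope f)
    (S : MapSquare f) where
  inclM : ∀ n, Hom (T.square n).M S.M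
  inclN : ∀ n, Hom (T.square n).N S.N
  colimitM : IsSequentialColimit (fun n => (T.ext n).i) inclM
  colimitN : IsSequentialColimit (fun n => (T.ext n).j) inclN
  top_comm : ∀ n, S.g.comp (inclM n) = (inclN n).comp (T.square n).g
  left_comm : ∀ n, S.m.comp (inclM n) = (T.square n).m
  right_comm : ∀ n, S.n.comp (inclN n) = (T.square n).n
  homotopy_comm : ∀ n, S.H.toHom.comp (inclM n) = (T.square n).H.toHom

end Maps

end CDGA

end

noncomputable section

open scoped TensorProduct DirectSum Polynomial

namespace CDGA

/-! ### Generalities -/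

/-! The cone of `m : M → A` measures what a `k`-minimal model still lacks: by the long exact
sequence, `H^(k+1)(C_m)` is an extension of the kernel of `H^(k+2)(m)` by the cokernel of
`H^(k+1)(m)`. A class represented by `(x, a)` becomes a generator of degree `k + 1` with
differential `x` and value `a`. Classes `(0, a)` supply the missing cohomology of `A`, and the
others bound the cocycles of `M` that die in `A`. Nothing else changes in low degrees: as `M⁰ = ℚ`,
`M¹ = 0` and `k + 1 ≥ 2`, the extension agrees with `M` in degrees below `k + 1` and in degree `k +
2`, and gains only the generators in degree `k + 1` (`HirschCarrier.Mon.low`). Hence a `k`-minimal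
approximation becomes a `(k + 1)`-minimal one (`Hom.IsApprox.coneExt`). Simple connectivity says
precisely that `ℚ → A` starts the induction at level `1`.

For a map, the image under `φ` of the representative of `α` and the representative of `φ_* α` differ
by a cone coboundary `d(w, b)`, with `(w, b)` linear in `α` (`MapSquare.exists_coneLift`). The
component `w` corrects the top map, `g(α) = φ_* α + w`. The component `b` closes the homotopy, `H(α)
= ∫₀ᵗ H(dα) + f(m(α)) ⊗ 1 + d(b ⊗ t)`: its value at `t = 1` is `n(g(α))` by the second component of
the cone equation. Since `w` has degree `k + 1` and `N` has generators only in degrees `≤ k`, it is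
decomposable, which gives the statement on linear parts.

In the colimit, cohomology in degree `n` is settled from a finite stage on, and the stages, with
some repeated, form the skeletal filtration.

Hirsch extensions are presented by generators and relations, and their structure comes from the
universal property: the grading from a map to polynomials recording degrees, the differential from a
map to triangular `2 × 2` matrices. No basis of monomials is required; spanning by monomials and an
algebra retraction onto `M` suffice. -/

/-- A family of submodules spanning a module and separated by projections is a grading. -/
@[reducible]
def decompositionOfProj {X : Type*} [AddCommGroup X] [Module ℚ X] (G : ℕ → Submodule ℚ X)
    (proj : ℕ → X →ₗ[ℚ] X) (h_same : ∀ n, ∀ x ∈ G n, proj n x = x)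
    (h_ne : ∀ m n, m ≠ n → ∀ x ∈ G m, proj n x = 0) (h_top : ⨆ n, G n = ⊤) :
    DirectSum.Decomposition G :=
  DirectSum.IsInternal.chooseDecomposition G <| by
    constructor
    -- Applying `proj n` to a finite sum of homogeneous elements returns its `n`-th term, so the sum
    -- determines its terms.
    · have key : ∀ n, (proj n) ∘ₗ DirectSum.coeLinearMap G =
          (G n).subtype ∘ₗ DirectSum.component ℚ ℕ (fun n => G n) n := by
        intro n
        refine DirectSum.linearMap_ext _ fun m => LinearMap.ext fun x => ?_
        simp only [LinearMap.comp_apply, DirectSum.coeLinearMap_lof, Submodule.subtype_apply]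
        by_cases h : m = n
        · subst h
          rw [h_same _ _ x.2, DirectSum.component.lof_self]
        · rw [h_ne _ _ h _ x.2, DirectSum.component.of, dif_neg h]
          rfl
      intro x y hxy
      refine DirectSum.ext_component ℚ fun n => Subtype.ext ?_
      have hx := LinearMap.congr_fun (key n) x
      have hy := LinearMap.congr_fun (key n) y
      simp only [LinearMap.comp_apply, Submodule.subtype_apply] at hx hy
      rw [← hx, ← hy]
      exact congrArg (proj n) hxy
    · intro x
      have hx : x ∈ ⨆ n, G n := h_top ▸ Submodule.mem_top
      rw [← DirectSum.range_coeLinearMap] at hx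
      exact hx

theorem one_mem_deg (A : CDGA.{u}) : (1 : A) ∈ A.deg 0 := SetLike.GradedOne.one_mem

theorem mul_mem_deg (A : CDGA.{u}) {i j : ℕ} {a b : A} (ha : a ∈ A.deg i) (hb : b ∈ A.deg j) :
    a * b ∈ A.deg (i + j) := SetLike.mul_mem_graded ha hb

theorem algebraMap_mem_deg (A : CDGA.{u}) (q : ℚ) : algebraMap ℚ A q ∈ A.deg 0 := by
  rw [Algebra.algebraMap_eq_smul_one]
  exact Submodule.smul_mem _ _ A.one_mem_deg

theorem d_one (A : CDGA.{u}) : A.d 1 = 0 := by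
  have h := A.leibniz A.one_mem_deg 1
  simpa using h

theorem d_algebraMap (A : CDGA.{u}) (q : ℚ) : A.d (algebraMap ℚ A q) = 0 := by
  rw [Algebra.algebraMap_eq_smul_one, map_smul, d_one, smul_zero]

theorem decompose_d_zero (A : CDGA.{u}) (a : A) :
    (DirectSum.decompose A.deg (A.d a) 0 : A) = 0 := by
  induction a using DirectSum.Decomposition.inductionOn A.deg with
  | zero => simp
  | add x y hx hy => simp [hx, hy]
  | homogeneous x => rw [DirectSum.decompose_of_mem_ne _ (A.d_mem x.2) (by omega)]

/-- There is no degree `-1`, so dividing by coboundaries has no effect on `H⁰`. -/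
theorem eq_zero_of_mem_range_d (A : CDGA.{u}) {a : A} (ha : a ∈ A.deg 0)
    (h : a ∈ LinearMap.range A.d) : a = 0 := by
  obtain ⟨b, rfl⟩ := h
  rw [← DirectSum.decompose_of_mem_same _ ha, decompose_d_zero]

theorem sign_mem (A : CDGA.{u}) {n : ℕ} {a : A} (ha : a ∈ A.deg n) : A.sign a ∈ A.deg n := by
  rw [sign_of_mem A ha]
  exact Submodule.smul_mem _ _ ha

theorem bilin_ext (A : CDGA.{u}) (B : CDGA.{v}) {N : Type*} [AddCommMonoid N] [Module ℚ N]
    {f g : A →ₗ[ℚ] B →ₗ[ℚ] N}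
    (h : ∀ i, ∀ a ∈ A.deg i, ∀ j, ∀ b ∈ B.deg j, f a b = g a b) : f = g :=
  lin_ext A fun i a ha => lin_ext B fun j b hb => h i a ha j b hb

theorem sign_mul (A : CDGA.{u}) (a b : A) : A.sign (a * b) = A.sign a * A.sign b := by
  have : LinearMap.compr₂ (LinearMap.mul ℚ A) A.sign =
      (LinearMap.mul ℚ A).compl₁₂ A.sign A.sign :=
    bilin_ext A A fun i a ha j b hb => by
      simp only [LinearMap.compr₂_apply, LinearMap.compl₁₂_apply, LinearMap.mul_apply',
        sign_of_mem A ha, sign_of_mem A hb, sign_of_mem A (A.mul_mem_deg ha hb), pow_add,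
        smul_mul_smul_comm]
  exact LinearMap.congr_fun₂ this a b

/-- With the sign operator the Leibniz rule needs no homogeneity. In this form it says that `a ↦
(sign a, d a; 0, a)` is multiplicative, which is how differentials are encoded in `diffHomM`. -/
theorem d_mul (A : CDGA.{u}) (a b : A) : A.d (a * b) = A.d a * b + A.sign a * A.d b := by
  have : LinearMap.compr₂ (LinearMap.mul ℚ A) A.d =
      (LinearMap.mul ℚ A).compl₁₂ A.d LinearMap.id +
        (LinearMap.mul ℚ A).compl₁₂ A.sign A.d :=
    bilin_ext A A fun i a ha j b hb => by
      simp only [LinearMap.compr₂_apply, LinearMap.compl₁₂_apply, LinearMap.mul_apply',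
        sign_of_mem A ha, LinearMap.add_apply, A.leibniz ha, smul_mul_assoc, LinearMap.id_apply]
  exact LinearMap.congr_fun₂ this a b

theorem sign_one (A : CDGA.{u}) : A.sign 1 = 1 := by
  rw [sign_of_mem A A.one_mem_deg]; simp

/-- The identity homomorphism. -/
def Hom.id (A : CDGA.{u}) : Hom A A where
  toAlgHom := AlgHom.id ℚ A
  map_deg h := h
  map_d _ := rfl

@[simp] theorem Hom.id_apply {A : CDGA.{u}} (a : A) : Hom.id A a = a := rfl

theorem Hom.congr {A : CDGA.{u}} {B : CDGA.{v}} {f g : Hom A B} (h : f = g) (a : A) :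
    f a = g a := by rw [h]

/-! ### The ground field -/

/-- The ground field `ℚ` as a CDGA concentrated in degree `0`. -/
def groundDeg : ℕ → Submodule ℚ (ULift.{u} ℚ)
  | 0 => ⊤
  | _ + 1 => ⊥

instance groundDecomposition : DirectSum.Decomposition groundDeg.{u} :=
  decompositionOfProj _ (fun n => match n with
      | 0 => LinearMap.id
      | _ + 1 => 0)
    (fun n x hx => by
      match n with
      | 0 => rfl
      | n + 1 => exact ((Submodule.mem_bot ℚ).1 hx).symm)
    (fun m n h x hx => by
      match m, n with
      | 0, 0 => exact absurd rfl h
      | 0, n + 1 => rfl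
      | m + 1, n => rw [(Submodule.mem_bot ℚ).1 hx, map_zero])
    (top_le_iff.1 (le_iSup groundDeg 0))

instance groundGradedAlgebra : GradedAlgebra groundDeg.{u} where
  one_mem := Submodule.mem_top
  mul_mem i j x y hx hy := by
    match i, j with
    | 0, 0 => exact Submodule.mem_top
    | 0, j + 1 => rw [(Submodule.mem_bot ℚ).1 hy, mul_zero]; exact zero_mem _
    | i + 1, j => rw [(Submodule.mem_bot ℚ).1 hx, zero_mul]; exact zero_mem _

/-- The ground field `ℚ` as a CDGA. -/
def ground : CDGA.{u} where
  carrier := ULift.{u} ℚ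
  deg := groundDeg
  d := 0
  d_mem _ := zero_mem _
  d_d _ := rfl
  leibniz _ _ := by simp
  graded_comm {i j a b} ha hb := by
    match i, j with
    | 0, j => simp [mul_comm]
    | i + 1, j => rw [(Submodule.mem_bot ℚ).1 ha]; simp

theorem ground_isGroundField : ground.{u}.IsGroundField :=
  ⟨fun _ _ h => congrArg ULift.down h, fun x => ⟨x.down, rfl⟩⟩

/-- The unit map of a CDGA. -/
def unitHom (A : CDGA.{v}) : Hom ground.{u} A where
  toAlgHom := (Algebra.ofId ℚ A).comp (ULift.algEquiv (R := ℚ) (A := ℚ)).toAlgHom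
  map_deg {n a} h := by
    match n with
    | 0 => exact A.algebraMap_mem_deg _
    | n + 1 =>
      have h0 : a = 0 := h
      rw [h0, map_zero]
      exact zero_mem _
  map_d a := by
    change (Algebra.ofId ℚ A) _ = A.d (algebraMap ℚ A _)
    rw [d_algebraMap]
    exact map_zero _

theorem IsGroundField.hom_apply_algebraMap {A : CDGA.{u}} {B : CDGA.{v}}
    (f : Hom A B) (q : ℚ) : f (algebraMap ℚ A q) = algebraMap ℚ B q := f.toAlgHom.commutes q

theorem IsGroundField.hom_ext {G : CDGA.{u}} (hG : G.IsGroundField) {A : CDGA.{v}}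
    (f g : Hom G A) : f = g := by
  ext x
  obtain ⟨q, rfl⟩ := hG.2 x
  rw [hom_apply_algebraMap, hom_apply_algebraMap]

/-! ### Evaluation and primitives on the interval -/

section Interval

variable (B : CDGA.{v})

theorem evalAt_pure (c : ℚ) (b : B) (x : interval) :
    evalAt B c (pure B interval b x) = intervalEval c x • b := contract_pure _ _ _ _

theorem intervalEval_mul (c : ℚ) (x y : interval) :
    intervalEval c (x * y) = intervalEval c x * intervalEval c y :=
  map_mul ((Polynomial.aeval c).comp (TrivSqZeroExt.fstHom ℚ ℚ[X] ℚ[X])) x y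

theorem intervalEval_one (c : ℚ) : intervalEval c (1 : interval) = 1 :=
  map_one ((Polynomial.aeval c).comp (TrivSqZeroExt.fstHom ℚ ℚ[X] ℚ[X]))

theorem intervalEval_of_mem (c : ℚ) {n : ℕ} {x : interval} (hx : x ∈ interval.deg (n + 1)) :
    intervalEval c x = 0 := by
  have h : TrivSqZeroExt.fst x = 0 := by
    match n with
    | 0 => exact hx
    | n + 1 =>
      have h0 : x = 0 := hx
      rw [h0]
      rfl
  change Polynomial.aeval c (TrivSqZeroExt.fst x) = 0
  rw [h, map_zero]

/-- The Koszul sign in the product of `a ⊗ b` and `a' ⊗ b'` involves the degree of the form `b`. It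
is trivial when that degree is `0`, and otherwise both sides vanish because `ε_c` kills forms of
positive degree. -/
theorem evalAt_mul (c : ℚ) (x y : tensor B interval) :
    evalAt B c (x * y) = evalAt B c x * evalAt B c y := by
  let e : TensorCarrier B interval →ₗ[ℚ] B := contract LinearMap.id (intervalEval c)
  have he : ∀ a b, e (pure B interval a b) = intervalEval c b • a := contract_pure _ _
  have h : ∀ i, ∀ a ∈ B.deg i, ∀ j, ∀ b ∈ interval.deg j, ∀ i', ∀ a' ∈ B.deg i', ∀ j',
      ∀ b' ∈ interval.deg j', e (pure B interval a b * pure B interval a' b') =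
        e (pure B interval a b) * e (pure B interval a' b') := by
    intro i a ha j b hb i' a' ha' j' b' hb'
    rw [pure_mul_pure a hb ha' b', map_smul, he, he, he, intervalEval_mul, smul_mul_smul_comm]
    match j with
    | 0 => simp
    | j + 1 => rw [intervalEval_of_mem c hb]; simp
  have h1 : ∀ i, ∀ a ∈ B.deg i, ∀ j, ∀ b ∈ interval.deg j,
      e ∘ₗ LinearMap.mulLeft ℚ (pure B interval a b) =
        LinearMap.mulLeft ℚ (e (pure B interval a b)) ∘ₗ e :=
    fun i a ha j b hb => tensor_lin_ext fun i' a' ha' j' b' hb' => h i a ha j b hb i' a' ha' j' b' hb'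
  have h2 : LinearMap.compr₂ (LinearMap.mul ℚ (TensorCarrier B interval)) e =
      (LinearMap.mul ℚ B).compl₁₂ e e :=
    tensor_lin_ext fun i a ha j b hb => h1 i a ha j b hb
  exact LinearMap.congr_fun₂ h2 x y

/-- Restriction to `t = c` as a homomorphism of CDGAs. -/
def evalHom (c : ℚ) : Hom (tensor B interval) B where
  toAlgHom := AlgHom.ofLinearMap (evalAt B c)
    (by
      change evalAt B c (pure B interval 1 1) = 1
      rw [evalAt_pure, intervalEval_one, one_smul])
    (evalAt_mul B c)
  map_deg {n x} hx := by
    change evalAt B c x ∈ B.deg n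
    induction hx using Submodule.span_induction with
    | zero => rw [map_zero]; exact zero_mem _
    | add x x' _ _ h1 h2 => rw [map_add]; exact add_mem h1 h2
    | smul c x _ h => rw [map_smul]; exact Submodule.smul_mem _ _ h
    | mem x h =>
      obtain ⟨i, j, rfl, a, ha, b, hb, rfl⟩ := h
      rw [evalAt_pure]
      match j with
      | 0 => exact Submodule.smul_mem _ _ ha
      | j + 1 => rw [intervalEval_of_mem c hb, zero_smul]; exact zero_mem _
  map_d x := by
    have : contract LinearMap.id (intervalEval c) ∘ₗ tensorD B interval =
        B.d ∘ₗ contract LinearMap.id (intervalEval c) :=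
      tensor_lin_ext fun i a ha j b hb => by
        simp only [LinearMap.comp_apply, tensorD_pure, map_add, contract_pure, map_smul]
        rw [intervalEval_of_mem c (interval.d_mem hb), zero_smul, add_zero]
        rfl
    exact LinearMap.congr_fun this x

@[simp] theorem evalHom_apply (c : ℚ) (x : tensor B interval) :
    evalHom B c x = evalAt B c x := rfl

/-! ### Primitives along the interval and lifting of paths -/

/-- The primitive `p + q dt ↦ ∫₀ᵗ q`. -/
def intervalPrimitive : interval →ₗ[ℚ] interval :=
  (TrivSqZeroExt.inlAlgHom ℚ ℚ[X] ℚ[X]).toLinearMap ∘ₗ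
    Polynomial.lsum (fun k : ℕ => (1 / ((k : ℚ) + 1)) • Polynomial.monomial (k + 1)) ∘ₗ
      (TrivSqZeroExt.sndHom ℚ[X] ℚ[X]).restrictScalars ℚ

theorem intervalPrimitive_d (x : interval) (hx : x ∈ interval.deg 0) :
    intervalPrimitive (interval.d x) = x - intervalEval 0 x • 1 := by
  have h : ∀ p : ℚ[X], Polynomial.lsum
      (fun k : ℕ => (1 / ((k : ℚ) + 1)) • Polynomial.monomial (R := ℚ) (k + 1))
        (Polynomial.derivative p) = p - Polynomial.aeval (0 : ℚ) p • 1 := by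
    intro p
    induction p using Polynomial.induction_on' with
    | add p q hp hq => simp only [map_add, hp, hq, add_smul]; ring
    | monomial n a =>
      rw [Polynomial.derivative_monomial, Polynomial.lsum_apply,
        Polynomial.sum_monomial_index _ _ (by simp)]
      cases n with
      | zero => simp [Polynomial.smul_eq_C_mul]
      | succ n =>
        have : (n : ℚ) + 1 ≠ 0 := by positivity
        simp [Polynomial.smul_monomial]
        field_simp
  have h0 : TrivSqZeroExt.snd x = 0 := hx
  refine TrivSqZeroExt.ext ?_ ?_
  · exact h (TrivSqZeroExt.fst x)
  · change (0 : ℚ[X]) = TrivSqZeroExt.snd x - (intervalEval 0 x) • (0 : ℚ[X])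
    rw [h0, smul_zero, sub_zero]

theorem d_intervalPrimitive (x : interval) (hx : x ∈ interval.deg 1) :
    interval.d (intervalPrimitive x) = x := by
  have h : ∀ p : ℚ[X], Polynomial.derivative (Polynomial.lsum
      (fun k : ℕ => (1 / ((k : ℚ) + 1)) • Polynomial.monomial (R := ℚ) (k + 1)) p) = p := by
    intro p
    induction p using Polynomial.induction_on' with
    | add p q hp hq => simp only [map_add, hp, hq]
    | monomial n a =>
      rw [Polynomial.lsum_apply, Polynomial.sum_monomial_index _ _ (by simp)]
      have : (n : ℚ) + 1 ≠ 0 := by positivity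
      simp [Polynomial.smul_monomial]
      field_simp
  have h0 : TrivSqZeroExt.fst x = 0 := hx
  refine TrivSqZeroExt.ext ?_ ?_
  · exact h0.symm
  · exact h (TrivSqZeroExt.snd x)

theorem intervalPrimitive_mem (x : interval) : intervalPrimitive x ∈ interval.deg 0 :=
  mem_intervalDeg_zero.2 (TrivSqZeroExt.snd_inl _ _)

theorem intervalPrimitive_of_mem_zero {x : interval} (hx : x ∈ interval.deg 0) :
    intervalPrimitive x = 0 := by
  have h0 : TrivSqZeroExt.snd x = 0 := hx
  change TrivSqZeroExt.inl (Polynomial.lsum _ (TrivSqZeroExt.snd x)) = (0 : TrivSqZeroExt ℚ[X] ℚ[X])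
  rw [h0, map_zero, TrivSqZeroExt.inl_zero]

theorem intervalEval_primitive_zero (x : interval) :
    intervalEval 0 (intervalPrimitive x) = 0 := by
  have h : ∀ p : ℚ[X], Polynomial.aeval (0 : ℚ) (Polynomial.lsum
      (fun k : ℕ => (1 / ((k : ℚ) + 1)) • Polynomial.monomial (R := ℚ) (k + 1)) p) = 0 := by
    intro p
    induction p using Polynomial.induction_on' with
    | add p q hp hq => simp only [map_add, hp, hq, add_zero]
    | monomial n a =>
      rw [Polynomial.lsum_apply, Polynomial.sum_monomial_index _ _ (by simp)]
      simp [Polynomial.smul_monomial]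
  exact h (TrivSqZeroExt.snd x)

theorem intervalEval_primitive_one (x : interval) :
    intervalEval 1 (intervalPrimitive x) = intervalIntegral x := by
  have h : ∀ p : ℚ[X], Polynomial.aeval (1 : ℚ) (Polynomial.lsum
      (fun k : ℕ => (1 / ((k : ℚ) + 1)) • Polynomial.monomial (R := ℚ) (k + 1)) p) =
      Polynomial.lsum (fun k : ℕ => (1 / ((k : ℚ) + 1)) • (LinearMap.id : ℚ →ₗ[ℚ] ℚ)) p := by
    intro p
    induction p using Polynomial.induction_on' with
    | add p q hp hq => simp only [map_add, hp, hq]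
    | monomial n a =>
      rw [Polynomial.lsum_apply, Polynomial.sum_monomial_index _ _ (by simp),
        Polynomial.lsum_apply, Polynomial.sum_monomial_index _ _ (by simp)]
      simp [Polynomial.smul_monomial]
  exact h (TrivSqZeroExt.snd x)

/-- The inclusion `b ↦ b ⊗ x`. -/
def pureRight (x : interval) : B →ₗ[ℚ] TensorCarrier B interval where
  toFun b := pure B interval b x
  map_add' a b := pure_add_left a b x
  map_smul' c b := pure_smul_left c b x

/-- The fibrewise primitive `b ⊗ ω ↦ (-1)^|b| b ⊗ ∫₀ᵗ ω`. -/
def primitive : TensorCarrier B interval →ₗ[ℚ] TensorCarrier B interval :=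
  (GradedTensorProduct.of ℚ B.deg interval.deg).toLinearMap ∘ₗ
    TensorProduct.map B.sign intervalPrimitive ∘ₗ
    (GradedTensorProduct.of ℚ B.deg interval.deg).symm.toLinearMap

theorem primitive_pure (b : B) (x : interval) :
    primitive B (pure B interval b x) = pure B interval (B.sign b) (intervalPrimitive x) := by
  simp only [primitive, pure]
  rfl

variable {B}

theorem primitive_mem {n : ℕ} {x : TensorCarrier B interval}
    (hx : x ∈ tensorDeg B interval (n + 1)) : primitive B x ∈ tensorDeg B interval n := by
  induction hx using Submodule.span_induction with
  | zero => rw [map_zero]; exact zero_mem _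
  | add x x' _ _ h1 h2 => rw [map_add]; exact add_mem h1 h2
  | smul c x _ h => rw [map_smul]; exact Submodule.smul_mem _ _ h
  | mem x h =>
    obtain ⟨i, j, hij, b, hb, y, hy, rfl⟩ := h
    rw [primitive_pure]
    match j with
    | 0 =>
      rw [intervalPrimitive_of_mem_zero hy, ← zero_smul ℚ (0 : interval), pure_smul_right,
        zero_smul]
      exact zero_mem _
    | 1 => exact pure_mem (by omega) (sign_mem B hb) (intervalPrimitive_mem y)
    | j + 2 =>
      have h0 : y = 0 := hy
      rw [h0, map_zero, ← zero_smul ℚ (0 : interval), pure_smul_right, zero_smul]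
      exact zero_mem _

/-- Poincaré lemma along the interval: the primitive is a contracting homotopy from `B ⊗ Λ(t, dt)`
onto the constant paths. The sign `(-1)^|b|` in `primitive` cancels the one in `d (b ⊗ ω)`, and the
terms with `db` cancel since `|db| = |b| + 1`. -/
theorem d_primitive (x : TensorCarrier B interval) :
    tensorD B interval (primitive B x) + primitive B (tensorD B interval x) =
      x - pureRight B 1 (evalAt B 0 x) := by
  have p0 : ∀ b : B, pure B interval b 0 = 0 := fun b => by
    rw [← zero_smul ℚ (0 : interval), pure_smul_right, zero_smul]
  let e : TensorCarrier B interval →ₗ[ℚ] B := contract LinearMap.id (intervalEval 0)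
  have : tensorD B interval ∘ₗ primitive B + primitive B ∘ₗ tensorD B interval =
      LinearMap.id - pureRight B 1 ∘ₗ e := tensor_lin_ext fun i b hb j y hy => by
    have sq : (-1 : ℚ) ^ i * (-1) ^ i = 1 := by rw [← mul_pow]; simp
    change tensorD B interval (primitive B _) + primitive B (tensorD B interval _) =
      pure B interval b y - pureRight B 1 (e _)
    have he : e (pure B interval b y) = intervalEval 0 y • b := contract_pure _ _ _ _
    rw [primitive_pure, tensorD_pure_of_mem (sign_mem B hb), tensorD_pure_of_mem hb,
      map_add, map_smul]
    simp only [primitive_pure, sign_of_mem B hb, sign_of_mem B (B.d_mem hb), map_smul,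
      pure_smul_left, he]
    change _ = pure B interval b y - (intervalEval 0 y) • pure B interval b 1
    rw [smul_smul, smul_smul, sq, one_smul, one_smul, pow_succ]
    -- For functions only `primitive ∘ d` produces a surviving term, namely `y - y(0)`; for
    -- one-forms only `d ∘ primitive` does, and `ε₀` vanishes.
    match j with
    | 0 =>
      rw [intervalPrimitive_of_mem_zero hy, map_zero, intervalPrimitive_d y hy, p0, p0,
        sub_eq_add_neg y, pure_add_right, ← neg_smul, pure_smul_right]
      module
    | 1 =>
      rw [d_intervalPrimitive y hy, intervalEval_of_mem 0 hy]
      have h2 : interval.d y = 0 := interval.d_mem hy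
      rw [h2, map_zero, p0]
      module
    | j + 2 =>
      have h0 : y = 0 := hy
      subst h0
      simp only [map_zero, p0]
      simp
  exact LinearMap.congr_fun this x

theorem evalAt_zero_primitive (x : TensorCarrier B interval) : evalAt B 0 (primitive B x) = 0 := by
  have : contract LinearMap.id (intervalEval 0) ∘ₗ primitive B = 0 :=
      tensor_lin_ext fun i b hb j y hy => by
    rw [LinearMap.comp_apply, primitive_pure, contract_pure, intervalEval_primitive_zero, zero_smul]
    rfl
  exact LinearMap.congr_fun this x

theorem evalAt_one_primitive (x : TensorCarrier B interval) :
    evalAt B 1 (primitive B x) = fiberIntegral B x := by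
  have : contract LinearMap.id (intervalEval 1) ∘ₗ primitive B =
      contract B.sign intervalIntegral := tensor_lin_ext fun i b hb j y hy => by
    rw [LinearMap.comp_apply, primitive_pure, contract_pure, contract_pure,
      intervalEval_primitive_one]
    rfl
  exact LinearMap.congr_fun this x

/-- The element `t` of `Λ(t, dt)`. -/
def tVar : interval := TrivSqZeroExt.inl (Polynomial.X : ℚ[X])

theorem tVar_mem : tVar ∈ interval.deg 0 := mem_intervalDeg_zero.2 (TrivSqZeroExt.snd_inl _ _)

theorem intervalEval_tVar (c : ℚ) : intervalEval c tVar = c := by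
  change Polynomial.aeval c (Polynomial.X : ℚ[X]) = c
  simp

theorem evalAt_pureRight (c : ℚ) (b : B) (x : interval) :
    evalAt B c (pureRight B x b) = intervalEval c x • b := evalAt_pure B c b x

theorem pureRight_mem {n : ℕ} {b : B} (hb : b ∈ B.deg n) {x : interval}
    (hx : x ∈ interval.deg 0) : pureRight B x b ∈ tensorDeg B interval n :=
  pure_mem (add_zero n) hb hx

theorem d_pureRight_one (b : B) :
    tensorD B interval (pureRight B 1 b) = pureRight B 1 (B.d b) := by
  change tensorD B interval (pure B interval b 1) = pure B interval (B.d b) 1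
  rw [tensorD_pure, d_one, ← zero_smul ℚ (0 : interval), pure_smul_right, zero_smul, add_zero]

/-- The path `∫₀ᵗ x + b ⊗ 1 + d (c ⊗ t)`. -/
def pathLift (B : CDGA.{v}) : TensorCarrier B interval × B × B →ₗ[ℚ] tensor B interval :=
  LinearMap.coprod (primitive B)
    (LinearMap.coprod (pureRight B 1) (tensorD B interval ∘ₗ pureRight B tVar))

theorem pathLift_mem {n : ℕ} {x : tensor B interval} {b c : B}
    (hx : x ∈ (tensor B interval).deg (n + 2)) (hb : b ∈ B.deg (n + 1)) (hc : c ∈ B.deg n) :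
    pathLift B (x, b, c) ∈ (tensor B interval).deg (n + 1) :=
  add_mem (primitive_mem hx) (add_mem (pureRight_mem hb interval.one_mem_deg)
    ((tensor B interval).d_mem (pureRight_mem hc tVar_mem)))

/-- For closed `x` the primitive has differential `x - ε₀(x) ⊗ 1`, and the constant path `b`
restores the missing term. The summand `d (c ⊗ t)` is closed, so it is free for adjusting the
endpoint. -/
theorem d_pathLift {x : tensor B interval} {b c : B} (hx : (tensor B interval).d x = 0)
    (hb : B.d b = evalAt B 0 x) :
    (tensor B interval).d (pathLift B (x, b, c)) = x := by
  have h := d_primitive (B := B) x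
  have h2 : tensorD B interval (tensorD B interval (pureRight B tVar c)) = 0 :=
    (tensor B interval).d_d _
  have h3 : tensorD B interval x = 0 := hx
  change tensorD B interval (primitive B x + (pureRight B 1 b +
      tensorD B interval (pureRight B tVar c))) = x
  rw [map_add, map_add, h2, d_pureRight_one, hb, add_zero]
  rw [h3, map_zero, add_zero] at h
  rw [h]
  exact sub_add_cancel x _

/-- Evaluation commutes with `d`, so `d (c ⊗ t)` restricts to `r • dc` at `t = r`: it fixes the
start of the path and moves its end by the coboundary `dc`. -/
theorem evalAt_pathLift (r : ℚ) {x : tensor B interval} {b c : B} :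
    evalAt B r (pathLift B (x, b, c)) = evalAt B r (primitive B x) + b + r • B.d c := by
  have h : evalAt B r (tensorD B interval (pureRight B tVar c)) = r • B.d c := by
    have h1 := (evalHom B r).map_d (pureRight B tVar c)
    have h2 : evalHom B r (pureRight B tVar c) = r • c :=
      (evalAt_pureRight r c tVar).trans (by rw [intervalEval_tVar])
    exact h1.trans (by rw [h2, map_smul])
  have h2 : evalAt B r (pureRight B 1 b) = b := by
    rw [evalAt_pureRight, intervalEval_one, one_smul]
  change contract LinearMap.id (intervalEval r) (primitive B x + (pureRight B 1 b +
      tensorD B interval (pureRight B tVar c))) = _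
  rw [map_add, map_add, add_assoc]
  exact congrArg₂ _ rfl (congrArg₂ _ h2 h)

theorem evalAt_zero_pathLift {x : tensor B interval} {b c : B} :
    evalAt B 0 (pathLift B (x, b, c)) = b := by
  have h : evalAt B 0 (primitive B x) = 0 := evalAt_zero_primitive x
  rw [evalAt_pathLift, h, zero_smul, zero_add, add_zero]

theorem evalAt_one_pathLift {x : tensor B interval} {b c : B} :
    evalAt B 1 (pathLift B (x, b, c)) = fiberIntegral B x + b + B.d c := by
  have h : evalAt B 1 (primitive B x) = fiberIntegral B x := evalAt_one_primitive x
  rw [evalAt_pathLift, h, one_smul]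

end Interval

/-! ### Construction of Hirsch extensions -/

section Hirsch

variable (M : CDGA.{u}) (k : ℕ) (V : Type u) [AddCommGroup V] [Module ℚ V]

/-- The relations defining `M⟨V⟩` as a quotient of the tensor algebra of `M ⊕ V`. -/
inductive HirschRel : TensorAlgebra ℚ (M × V) → TensorAlgebra ℚ (M × V) → Prop
  | one : HirschRel (TensorAlgebra.ι ℚ (1, 0)) 1
  | mul (a b : M) : HirschRel (TensorAlgebra.ι ℚ (a * b, 0))
      (TensorAlgebra.ι ℚ (a, 0) * TensorAlgebra.ι ℚ (b, 0))
  | gen (v w : V) : HirschRel (TensorAlgebra.ι ℚ (0, v) * TensorAlgebra.ι ℚ (0, w))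
      ((-1 : ℚ) ^ (k * k) • (TensorAlgebra.ι ℚ (0, w) * TensorAlgebra.ι ℚ (0, v)))
  | comm (i : ℕ) (a : M) (ha : a ∈ M.deg i) (v : V) :
      HirschRel (TensorAlgebra.ι ℚ (a, 0) * TensorAlgebra.ι ℚ (0, v))
        ((-1 : ℚ) ^ (i * k) • (TensorAlgebra.ι ℚ (0, v) * TensorAlgebra.ι ℚ (a, 0)))

/-- The underlying algebra of the Hirsch extension `M⟨V⟩` with generators in degree `k`. -/
abbrev HirschCarrier : Type u := RingQuot (HirschRel M k V)

namespace HirschCarrier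

/-- The inclusion of `M ⊕ V`. -/
def incl : M × V →ₗ[ℚ] HirschCarrier M k V :=
  (RingQuot.mkAlgHom ℚ (HirschRel M k V)).toLinearMap ∘ₗ TensorAlgebra.ι ℚ

theorem incl_apply (x : M × V) :
    incl M k V x = RingQuot.mkAlgHom ℚ (HirschRel M k V) (TensorAlgebra.ι ℚ x) := rfl

/-- The inclusion of `M`. -/
def inM : M →ₐ[ℚ] HirschCarrier M k V :=
  AlgHom.ofLinearMap (incl M k V ∘ₗ LinearMap.inl ℚ M V)
    (by
      rw [LinearMap.comp_apply, LinearMap.inl_apply, incl_apply,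
        RingQuot.mkAlgHom_rel ℚ HirschRel.one, map_one])
    (fun a b => by
      simp only [LinearMap.comp_apply, LinearMap.inl_apply, incl_apply]
      rw [RingQuot.mkAlgHom_rel ℚ (HirschRel.mul a b), map_mul])

/-- The inclusion of the generators. -/
def inV : V →ₗ[ℚ] HirschCarrier M k V := incl M k V ∘ₗ LinearMap.inr ℚ M V

variable {M k V}

theorem inM_apply (a : M) : inM M k V a =
    RingQuot.mkAlgHom ℚ (HirschRel M k V) (TensorAlgebra.ι ℚ (a, 0)) := rfl

theorem inV_apply (v : V) : inV M k V v =
    RingQuot.mkAlgHom ℚ (HirschRel M k V) (TensorAlgebra.ι ℚ (0, v)) := rfl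

theorem inV_mul_inV (v w : V) :
    inV M k V v * inV M k V w = (-1 : ℚ) ^ (k * k) • (inV M k V w * inV M k V v) := by
  rw [inV_apply, inV_apply, ← map_mul, RingQuot.mkAlgHom_rel ℚ (HirschRel.gen v w), map_smul,
    map_mul]

theorem inM_mul_inV {i : ℕ} {a : M} (ha : a ∈ M.deg i) (v : V) :
    inM M k V a * inV M k V v = (-1 : ℚ) ^ (i * k) • (inV M k V v * inM M k V a) := by
  rw [inV_apply, inM_apply, ← map_mul, RingQuot.mkAlgHom_rel ℚ (HirschRel.comm i a ha v), map_smul,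
    map_mul]

section Lift

variable {C : Type w} [Ring C] [Algebra ℚ C]

/-- The universal property of the underlying algebra of `M⟨V⟩`. -/
def lift (F : M →ₐ[ℚ] C) (φ : V →ₗ[ℚ] C)
    (h_gen : ∀ v w, φ v * φ w = (-1 : ℚ) ^ (k * k) • (φ w * φ v))
    (h_comm : ∀ i, ∀ a ∈ M.deg i, ∀ v, F a * φ v = (-1 : ℚ) ^ (i * k) • (φ v * F a)) :
    HirschCarrier M k V →ₐ[ℚ] C :=
  RingQuot.liftAlgHom ℚ ⟨TensorAlgebra.lift ℚ (F.toLinearMap.coprod φ), fun x y h => by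
    cases h with
    | one => simp
    | mul a b => simp
    | gen v w => simpa using h_gen v w
    | comm i a ha v => simpa using h_comm i a ha v⟩

variable {F : M →ₐ[ℚ] C} {φ : V →ₗ[ℚ] C}
    {h_gen : ∀ v w, φ v * φ w = (-1 : ℚ) ^ (k * k) • (φ w * φ v)}
    {h_comm : ∀ i, ∀ a ∈ M.deg i, ∀ v, F a * φ v = (-1 : ℚ) ^ (i * k) • (φ v * F a)}

@[simp] theorem lift_inM (a : M) : lift F φ h_gen h_comm (inM M k V a) = F a := by
  rw [inM_apply, lift, RingQuot.liftAlgHom_mkAlgHom_apply]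
  simp

@[simp] theorem lift_inV (v : V) : lift F φ h_gen h_comm (inV M k V v) = φ v := by
  rw [inV_apply, lift, RingQuot.liftAlgHom_mkAlgHom_apply]
  simp

theorem algHom_ext {f g : HirschCarrier M k V →ₐ[ℚ] C}
    (hM : ∀ a, f (inM M k V a) = g (inM M k V a)) (hV : ∀ v, f (inV M k V v) = g (inV M k V v)) :
    f = g := by
  refine RingQuot.ringQuot_ext' ℚ _ _ (TensorAlgebra.hom_ext (LinearMap.ext fun x => ?_))
  obtain ⟨a, v⟩ := x
  have hx : ((a, v) : M × V) = (a, 0) + (0, v) := by simp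
  rw [hx, map_add, map_add]
  exact congrArg₂ _ (hM a) (hV v)

end Lift

/-! #### The grading -/

variable (M k V) in
/-- The homogeneous generators of `M⟨V⟩`. -/
inductive Gen : ℕ → HirschCarrier M k V → Prop
  | ofM {i : ℕ} {a : M} (ha : a ∈ M.deg i) : Gen i (inM M k V a)
  | ofV (v : V) : Gen k (inV M k V v)

variable (M k V) in
/-- The monomials in the homogeneous generators. -/
inductive Mon : ℕ → HirschCarrier M k V → Prop
  | one : Mon 0 1
  | mul {i n m : ℕ} {g x : HirschCarrier M k V} (h : i + n = m) (hg : Gen M k V i g)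
      (hx : Mon n x) : Mon m (g * x)

variable (M k V) in
/-- The homogeneous parts of `M⟨V⟩`. -/
def deg (n : ℕ) : Submodule ℚ (HirschCarrier M k V) := Submodule.span ℚ {x | Mon M k V n x}

theorem Mon.mem {n : ℕ} {x : HirschCarrier M k V} (h : Mon M k V n x) : x ∈ deg M k V n :=
  Submodule.subset_span h

theorem Gen.mem {n : ℕ} {x : HirschCarrier M k V} (h : Gen M k V n x) : x ∈ deg M k V n := by
  rw [← mul_one x]
  exact (Mon.mul (add_zero n) h Mon.one).mem

theorem Mon.mul_mon {m : ℕ} {x : HirschCarrier M k V} (hx : Mon M k V m x) :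
    ∀ {n : ℕ} {y : HirschCarrier M k V}, Mon M k V n y → Mon M k V (m + n) (x * y) := by
  induction hx with
  | one => intro n y hy; rwa [zero_add, one_mul]
  | mul h hg _ ih =>
    intro n y hy
    rw [mul_assoc]
    exact Mon.mul (by omega) hg (ih hy)

theorem mul_mem {m n : ℕ} {x y : HirschCarrier M k V} (hx : x ∈ deg M k V m)
    (hy : y ∈ deg M k V n) : x * y ∈ deg M k V (m + n) := by
  induction hx using Submodule.span_induction with
  | zero => rw [zero_mul]; exact zero_mem _
  | add x x' _ _ h1 h2 => rw [add_mul]; exact add_mem h1 h2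
  | smul c x _ h => rw [smul_mul_assoc]; exact Submodule.smul_mem _ _ h
  | mem x h =>
    induction hy using Submodule.span_induction with
    | zero => rw [mul_zero]; exact zero_mem _
    | add x x' _ _ h1 h2 => rw [mul_add]; exact add_mem h1 h2
    | smul c x _ h => rw [mul_smul_comm]; exact Submodule.smul_mem _ _ h
    | mem y h' => exact (h.mul_mon h').mem

variable (M k V) in
-- The sum of the homogeneous parts is a subalgebra `S` containing the generators. The universal
-- property gives a map to `S` whose composite with the inclusion fixes the generators, hence is the
-- identity; so `S` is everything.
theorem iSup_deg : ⨆ n, deg M k V n = ⊤ := by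
  let S : Subalgebra ℚ (HirschCarrier M k V) :=
    Submodule.toSubalgebra (⨆ n, deg M k V n) (Submodule.mem_iSup_of_mem 0 Mon.one.mem)
      (fun x y hx hy => by
        refine Submodule.iSup_induction (motive := fun x => x * y ∈ ⨆ n, deg M k V n) _ hx
          (fun i x hx => ?_) (by rw [zero_mul]; exact zero_mem _)
          (fun a b ha hb => by rw [add_mul]; exact add_mem ha hb)
        refine Submodule.iSup_induction (motive := fun y => x * y ∈ ⨆ n, deg M k V n) _ hy
          (fun j y hy => ?_) (by rw [mul_zero]; exact zero_mem _)
          (fun a b ha hb => by rw [mul_add]; exact add_mem ha hb)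
        exact Submodule.mem_iSup_of_mem (i + j) (mul_mem hx hy))
  have hM : ∀ a, inM M k V a ∈ S := fun a => by
    induction a using DirectSum.Decomposition.inductionOn M.deg with
    | zero => rw [map_zero]; exact zero_mem S
    | add x y hx hy => rw [map_add]; exact add_mem hx hy
    | homogeneous x => exact Submodule.mem_iSup_of_mem _ (Gen.ofM x.2).mem
  have hV : ∀ v, inV M k V v ∈ S := fun v => Submodule.mem_iSup_of_mem k (Gen.ofV v).mem
  let r : HirschCarrier M k V →ₐ[ℚ] S := lift (M := M) (k := k) (V := V) (C := S)
    ((inM M k V).codRestrict S hM)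
    (LinearMap.codRestrict (Subalgebra.toSubmodule S) (inV M k V) hV)
    (fun v w => Subtype.ext (inV_mul_inV v w)) (fun i a ha v => Subtype.ext (inM_mul_inV ha v))
  have hr : S.val.comp r = AlgHom.id ℚ _ := algHom_ext
    (fun a => by
      rw [AlgHom.comp_apply, lift_inM]
      rfl)
    (fun v => by
      rw [AlgHom.comp_apply, lift_inV]
      rfl)
  refine eq_top_iff.2 fun x _ => ?_
  have h := AlgHom.congr_fun hr x
  rw [AlgHom.id_apply] at h
  rw [← h]
  exact (r x).2

@[elab_as_elim]
theorem mon_induction {p : HirschCarrier M k V → Prop} (x : HirschCarrier M k V)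
    (mon : ∀ n x, Mon M k V n x → p x) (zero : p 0)
    (add : ∀ x y, p x → p y → p (x + y)) (smul : ∀ (c : ℚ) x, p x → p (c • x)) : p x := by
  have hx : x ∈ ⨆ n, deg M k V n := iSup_deg M k V ▸ Submodule.mem_top
  refine Submodule.iSup_induction (motive := p) _ hx (fun i x hx => ?_) zero add
  induction hx using Submodule.span_induction with
  | zero => exact zero
  | add x x' _ _ h1 h2 => exact add _ _ h1 h2
  | smul c x _ h => exact smul _ _ h
  | mem x h => exact mon _ _ h

variable (M) in
/-- The homomorphism `M → M[X]` sending `a` of degree `i` to `a Xⁱ`. -/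
def degreeLin : M →ₗ[ℚ] (M : Type u)[X] :=
  DirectSum.toModule ℚ ℕ _ (fun n =>
      ((Polynomial.monomial n : M →ₗ[M] (M : Type u)[X]).restrictScalars ℚ) ∘ₗ
        (M.deg n).subtype) ∘ₗ
    (DirectSum.decomposeLinearEquiv M.deg).toLinearMap

theorem degreeLin_of_mem {n : ℕ} {a : M} (ha : a ∈ M.deg n) :
    degreeLin M a = Polynomial.monomial n a := by
  have h : DirectSum.decomposeLinearEquiv M.deg a = DirectSum.lof ℚ ℕ _ n ⟨a, ha⟩ :=
    DirectSum.decomposeLinearEquiv_apply_coe M.deg n ⟨a, ha⟩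
  rw [degreeLin, LinearMap.comp_apply, LinearEquiv.coe_coe, h, DirectSum.toModule_lof]
  rfl

variable (M) in
/-- The homomorphism `M → M[X]` sending `a` of degree `i` to `a Xⁱ`, as an algebra map. -/
def degreeHom : M →ₐ[ℚ] (M : Type u)[X] :=
  AlgHom.ofLinearMap (degreeLin M) (by rw [degreeLin_of_mem M.one_mem_deg]; rfl) (fun a b => by
    have : LinearMap.compr₂ (LinearMap.mul ℚ M) (degreeLin M) =
        (LinearMap.mul ℚ (M : Type u)[X]).compl₁₂ (degreeLin M) (degreeLin M) :=
      bilin_ext M M fun i a ha j b hb => by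
        simp only [LinearMap.compr₂_apply, LinearMap.compl₁₂_apply, LinearMap.mul_apply',
          degreeLin_of_mem ha, degreeLin_of_mem hb, degreeLin_of_mem (M.mul_mem_deg ha hb),
          Polynomial.monomial_mul_monomial]
    exact LinearMap.congr_fun₂ this a b)

theorem degreeHom_of_mem {n : ℕ} {a : M} (ha : a ∈ M.deg n) :
    degreeHom M a = Polynomial.monomial n a := degreeLin_of_mem ha

variable (M k V) in
/-- The linear map `V → M⟨V⟩[X]` sending `v` to `v Xᵏ`. -/
def degreeGen : V →ₗ[ℚ] (HirschCarrier M k V)[X] :=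
  ((Polynomial.monomial k :
    HirschCarrier M k V →ₗ[HirschCarrier M k V] (HirschCarrier M k V)[X]).restrictScalars ℚ) ∘ₗ
      inV M k V

theorem degreeGen_apply (v : V) :
    degreeGen M k V v = Polynomial.monomial k (inV M k V v) := rfl

variable (M k V) in
/-- The homomorphism `M⟨V⟩ → M⟨V⟩[X]` sending `x` of degree `i` to `x Xⁱ`. -/
def degHom : HirschCarrier M k V →ₐ[ℚ] (HirschCarrier M k V)[X] :=
  lift (M := M) (k := k) (V := V) (C := (HirschCarrier M k V)[X])
    ((Polynomial.mapAlgHom (inM M k V)).comp (degreeHom M))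
    (degreeGen M k V)
    (fun v w => by
      simp only [degreeGen_apply, Polynomial.monomial_mul_monomial]
      rw [inV_mul_inV, Polynomial.smul_monomial])
    (fun i a ha v => by
      simp only [degreeGen_apply, AlgHom.comp_apply, degreeHom_of_mem ha,
        Polynomial.coe_mapAlgHom, Polynomial.map_monomial]
      rw [Polynomial.monomial_mul_monomial, Polynomial.monomial_mul_monomial,
        Polynomial.smul_monomial, add_comm k i]
      exact congrArg _ (inM_mul_inV ha v))

/-- This makes the sum of the homogeneous parts direct: the coefficient of `Xⁿ` in `degHom M k V x`
is the component of `x` in degree `n`. The map exists because the defining relations are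
homogeneous. -/
theorem degHom_of_mem {n : ℕ} {x : HirschCarrier M k V} (hx : x ∈ deg M k V n) :
    degHom M k V x = Polynomial.monomial n x := by
  induction hx using Submodule.span_induction with
  | zero => simp
  | add x x' _ _ h1 h2 => rw [map_add, h1, h2, map_add]
  | smul c x _ h => rw [map_smul, h, Polynomial.smul_monomial]
  | mem x h =>
    induction h with
    | one => rw [map_one]; rfl
    | mul h hg _ ih =>
      rw [map_mul, ih, ← h, ← Polynomial.monomial_mul_monomial]
      congr 1
      cases hg with
      | ofM ha => simp [degHom, degreeHom_of_mem ha]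
      | ofV v => simp [degHom, degreeGen_apply]

instance decomposition : DirectSum.Decomposition (deg M k V) :=
  decompositionOfProj _
    (fun n => ((Polynomial.lcoeff (HirschCarrier M k V) n).restrictScalars ℚ) ∘ₗ
      (degHom M k V).toLinearMap)
    (fun n x hx => by simp [degHom_of_mem hx])
    (fun m n h x hx => by simp [degHom_of_mem hx, Polynomial.coeff_monomial, h])
    (iSup_deg M k V)

instance gradedAlgebra : GradedAlgebra (deg M k V) where
  one_mem := Mon.one.mem
  mul_mem _ _ _ _ hx hy := mul_mem hx hy

theorem Gen.comm {i j : ℕ} {g h : HirschCarrier M k V} (hg : Gen M k V i g)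
    (hh : Gen M k V j h) : g * h = (-1 : ℚ) ^ (i * j) • (h * g) := by
  cases hg with
  | ofM ha =>
    cases hh with
    | ofM hb => rw [← map_mul, M.graded_comm ha hb, map_smul, map_mul]
    | ofV v => exact inM_mul_inV ha v
  | ofV v =>
    cases hh with
    | ofM hb =>
      rw [inM_mul_inV hb v, smul_smul, mul_comm k j, ← mul_pow]
      simp
    | ofV w => exact inV_mul_inV v w

theorem Gen.comm_mon {i j : ℕ} {g x : HirschCarrier M k V} (hg : Gen M k V i g)
    (hx : Mon M k V j x) : g * x = (-1 : ℚ) ^ (i * j) • (x * g) := by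
  induction hx with
  | one => simp
  | @mul p n m h x e hh hx ih =>
    rw [← mul_assoc, hg.comm hh, smul_mul_assoc, mul_assoc, ih, mul_smul_comm, smul_smul,
      mul_assoc, ← e, mul_add, pow_add]

theorem Mon.comm {i j : ℕ} {x y : HirschCarrier M k V} (hx : Mon M k V i x)
    (hy : Mon M k V j y) : x * y = (-1 : ℚ) ^ (i * j) • (y * x) := by
  induction hx with
  | one => simp
  | @mul p n m h x e hh hx ih =>
    rw [mul_assoc, ih, mul_smul_comm, ← mul_assoc, hh.comm_mon hy, smul_mul_assoc, smul_smul,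
      mul_assoc, ← e, add_mul, pow_add, mul_comm]

theorem deg_comm {i j : ℕ} {x y : HirschCarrier M k V} (hx : x ∈ deg M k V i)
    (hy : y ∈ deg M k V j) : x * y = (-1 : ℚ) ^ (i * j) • (y * x) := by
  induction hx using Submodule.span_induction with
  | zero => simp
  | add x x' _ _ h1 h2 => rw [add_mul, mul_add, h1, h2, smul_add]
  | smul c x _ h => rw [smul_mul_assoc, h, mul_smul_comm, smul_comm]
  | mem x h =>
    induction hy using Submodule.span_induction with
    | zero => simp
    | add x x' _ _ h1 h2 => rw [add_mul, mul_add, h1, h2, smul_add]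
    | smul c x _ h => rw [mul_smul_comm, h, smul_mul_assoc, smul_comm]
    | mem y h' => exact h.comm h'

/-! #### The differential -/

section Differential

variable (τ : V →ₗ[ℚ] M) (hτ : ∀ v, τ v ∈ M.deg (k + 1))

theorem neg_one_pow_sq (n : ℕ) : (-1 : ℚ) ^ n * (-1) ^ n = 1 := by rw [← mul_pow]; simp

/-- The homomorphism `a ↦ (± a, da; 0, a)` encoding the differential of `M`. -/
def diffHomM : M →ₐ[ℚ] Matrix (Fin 2) (Fin 2) (HirschCarrier M k V) :=
  AlgHom.ofLinearMap
    { toFun := fun a => !![inM M k V (M.sign a), inM M k V (M.d a); 0, inM M k V a]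
      map_add' := fun a b => by ext i j; fin_cases i <;> fin_cases j <;> simp
      map_smul' := fun c a => by ext i j; fin_cases i <;> fin_cases j <;> simp }
    (by
      ext i j
      fin_cases i <;> fin_cases j <;> simp [M.sign_one, M.d_one])
    (fun a b => by
      ext i j
      fin_cases i <;> fin_cases j <;> simp [Matrix.mul_apply, M.sign_mul, M.d_mul, add_comm])

/-- The linear map `v ↦ (± v, τ v; 0, v)` encoding the differential on the generators. -/
def diffHomV : V →ₗ[ℚ] Matrix (Fin 2) (Fin 2) (HirschCarrier M k V) where
  toFun v := !![(-1 : ℚ) ^ k • inV M k V v, inM M k V (τ v); 0, inV M k V v]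
  map_add' a b := by ext i j; fin_cases i <;> fin_cases j <;> simp
  map_smul' c a := by
    ext i j; fin_cases i <;> fin_cases j <;> simp [smul_comm c]

/-- The homomorphism `x ↦ (± x, dx; 0, x)` encoding the differential of `M⟨V⟩`. -/
def diffHom : HirschCarrier M k V →ₐ[ℚ] Matrix (Fin 2) (Fin 2) (HirschCarrier M k V) :=
  lift diffHomM (diffHomV τ)
    (fun v w => by
      have h1 := inV_mul_inV (M := M) (k := k) v w
      have h2 := inM_mul_inV (k := k) (hτ w) v
      have h3 := inM_mul_inV (k := k) (hτ v) w
      -- Elements of degree `k + 1` commute strictly with those of degree `k`. Together with `k² ≡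
      -- k` modulo `2`, this makes the upper right entries agree, i.e. the prospective differential
      -- respects the commutation of two generators.
      have e : (-1 : ℚ) ^ ((k + 1) * k) = 1 :=
        Even.neg_one_pow (by rw [mul_comm]; exact Nat.even_mul_succ_self k)
      have e' : (-1 : ℚ) ^ (k * k) = (-1) ^ k := by
        have := neg_one_pow_sq k
        have h4 : (-1 : ℚ) ^ (k * k) * (-1) ^ k = 1 := by
          rw [← pow_add, show k * k + k = (k + 1) * k by ring, e]
        linear_combination (-1 : ℚ) ^ k * h4 - (-1 : ℚ) ^ (k * k) * this
      rw [e, one_smul] at h2 h3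
      ext i j
      fin_cases i <;> fin_cases j <;> simp [diffHomV, Matrix.mul_apply]
      · rw [h1, smul_comm]
        simp only [smul_smul]
        congr 1
        ring
      · rw [h2, h3, smul_smul, e', neg_one_pow_sq, one_smul, add_comm]
      · exact h1)
    (fun i a ha v => by
      have h1 := inM_mul_inV (k := k) ha v
      have h2 := inM_mul_inV (k := k) (M.d_mem ha) v
      have h3 : inM M k V a * inM M k V (τ v) =
          (-1 : ℚ) ^ (i * (k + 1)) • (inM M k V (τ v) * inM M k V a) := by
        rw [← map_mul, M.graded_comm ha (hτ v), map_smul, map_mul]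
      ext p q
      fin_cases p <;> fin_cases q <;> simp [diffHomV, diffHomM, Matrix.mul_apply, sign_of_mem M ha]
      · rw [h1]
        simp only [smul_smul]
        congr 1
        ring
      · rw [h2, h3]
        simp only [smul_smul]
        rw [add_comm]
        congr 2
        · rw [add_mul, pow_add, one_mul]
        · rw [mul_add, pow_add, mul_one]
          linear_combination (-1 : ℚ) ^ (i * k) * neg_one_pow_sq i
      · exact h1)

/-- The differential of `M⟨V⟩`. -/
def diff : HirschCarrier M k V →ₗ[ℚ] HirschCarrier M k V :=
  LinearMap.proj (R := ℚ) (1 : Fin 2) ∘ₗ LinearMap.proj (R := ℚ) (0 : Fin 2) ∘ₗ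
    (Matrix.ofLinearEquiv ℚ).symm.toLinearMap ∘ₗ (diffHom τ hτ).toLinearMap

theorem diff_apply (x : HirschCarrier M k V) : diff τ hτ x = diffHom τ hτ x 0 1 := rfl

@[simp] theorem diff_inM (a : M) : diff τ hτ (inM M k V a) = inM M k V (M.d a) := by
  simp [diff_apply, diffHom, diffHomM]

@[simp] theorem diff_inV (v : V) : diff τ hτ (inV M k V v) = inM M k V (τ v) := by
  simp [diff_apply, diffHom, diffHomV]

theorem Gen.diffHom_zero_zero {n : ℕ} {g : HirschCarrier M k V} (hg : Gen M k V n g) :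
    diffHom τ hτ g 0 0 = (-1 : ℚ) ^ n • g ∧ diffHom τ hτ g 1 0 = 0 ∧ diffHom τ hτ g 1 1 = g := by
  cases hg with
  | ofM ha => simp [diffHom, diffHomM, sign_of_mem M ha]
  | ofV v => simp [diffHom, diffHomV]

theorem Mon.diffHom_zero_zero {n : ℕ} {x : HirschCarrier M k V} (hx : Mon M k V n x) :
    diffHom τ hτ x 0 0 = (-1 : ℚ) ^ n • x ∧ diffHom τ hτ x 1 0 = 0 ∧ diffHom τ hτ x 1 1 = x := by
  induction hx with
  | one => simp
  | mul h hg hx ih =>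
    obtain ⟨h1, h2, h3⟩ := hg.diffHom_zero_zero τ hτ
    obtain ⟨i1, i2, i3⟩ := ih
    simp only [map_mul, Matrix.mul_apply, Fin.sum_univ_two, h1, h2, h3, i1, i2, i3, mul_zero,
      zero_mul, add_zero, zero_add, smul_mul_smul_comm, ← pow_add, h, and_self]

theorem diffHom_one_one (x : HirschCarrier M k V) : diffHom τ hτ x 1 1 = x := by
  induction x using mon_induction with
  | mon n x h => exact (h.diffHom_zero_zero τ hτ).2.2
  | zero => simp
  | add x y hx hy => rw [map_add, Matrix.add_apply, hx, hy]
  | smul c x hx => rw [map_smul, Matrix.smul_apply, hx]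

theorem diffHom_zero_zero {n : ℕ} {x : HirschCarrier M k V} (hx : x ∈ deg M k V n) :
    diffHom τ hτ x 0 0 = (-1 : ℚ) ^ n • x := by
  induction hx using Submodule.span_induction with
  | zero => simp
  | add x x' _ _ h1 h2 => rw [map_add, Matrix.add_apply, h1, h2, smul_add]
  | smul c x _ h => rw [map_smul, Matrix.smul_apply, h, smul_comm]
  | mem x h => exact (h.diffHom_zero_zero τ hτ).1

/-- The upper right entry of the product of `(± x, dx; 0, x)` and `(± y, dy; 0, y)` is the Leibniz
formula. -/
theorem diff_mul {n : ℕ} {x : HirschCarrier M k V} (hx : x ∈ deg M k V n)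
    (y : HirschCarrier M k V) :
    diff τ hτ (x * y) = diff τ hτ x * y + (-1 : ℚ) ^ n • (x * diff τ hτ y) := by
  simp only [diff_apply, map_mul, Matrix.mul_apply, Fin.sum_univ_two, diffHom_one_one,
    diffHom_zero_zero τ hτ hx, smul_mul_assoc]
  rw [add_comm]

theorem Gen.diff_mem {n : ℕ} {g : HirschCarrier M k V} (hg : Gen M k V n g) :
    diff τ hτ g ∈ deg M k V (n + 1) := by
  cases hg with
  | ofM ha => rw [diff_inM]; exact (Gen.ofM (M.d_mem ha)).mem
  | ofV v => rw [diff_inV]; exact (Gen.ofM (hτ v)).mem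

theorem diff_one : diff τ hτ 1 = 0 := by
  rw [← map_one (inM M k V), diff_inM, M.d_one, map_zero]

theorem diff_mem {n : ℕ} {x : HirschCarrier M k V} (hx : x ∈ deg M k V n) :
    diff τ hτ x ∈ deg M k V (n + 1) := by
  induction hx using Submodule.span_induction with
  | zero => rw [map_zero]; exact zero_mem _
  | add x x' _ _ h1 h2 => rw [map_add]; exact add_mem h1 h2
  | smul c x _ h => rw [map_smul]; exact Submodule.smul_mem _ _ h
  | mem x h =>
    induction h with
    | one => rw [diff_one]; exact zero_mem _
    | @mul i n m g x h hg hx ih =>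
      subst h
      rw [diff_mul τ hτ hg.mem]
      have h2 := mul_mem hg.mem ih
      rw [← add_assoc] at h2
      refine add_mem ?_ (Submodule.smul_mem _ _ h2)
      rw [add_right_comm]
      exact mul_mem (hg.diff_mem τ hτ) hx.mem

/-- In the square of an odd derivation the cross terms `dg · dx` cancel, so vanishing passes from
generators to monomials; on generators it is `d² = 0` in `M` and closedness of `τ v`. -/
theorem diff_diff (hd : ∀ v, M.d (τ v) = 0) (x : HirschCarrier M k V) : diff τ hτ (diff τ hτ x) = 0 := by
  induction x using mon_induction with
  | zero => simp
  | add x y hx hy => rw [map_add, map_add, hx, hy, add_zero]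
  | smul c x hx => rw [map_smul, map_smul, hx, smul_zero]
  | mon n x h =>
    induction h with
    | one => rw [diff_one, map_zero]
    | @mul i n m g x h hg hx ih =>
      have hgg : diff τ hτ (diff τ hτ g) = 0 := by
        cases hg with
        | ofM ha => rw [diff_inM, diff_inM, M.d_d, map_zero]
        | ofV v => rw [diff_inV, diff_inM, hd, map_zero]
      rw [diff_mul τ hτ hg.mem, map_add, diff_mul τ hτ (hg.diff_mem τ hτ), map_smul,
        diff_mul τ hτ hg.mem, ih, hgg, pow_succ, zero_mul, mul_zero, smul_zero, add_zero, zero_add]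
      module

end Differential

end HirschCarrier

end Hirsch

theorem map_decomposables {A B : CDGA.{u}} (f : Hom A B) {a : A} (ha : a ∈ A.decomposables) :
    f a ∈ B.decomposables := by
  induction ha using Submodule.span_induction with
  | zero => rw [map_zero]; exact zero_mem _
  | add x x' _ _ h1 h2 => rw [map_add]; exact add_mem h1 h2
  | smul c x _ h => rw [map_smul]; exact Submodule.smul_mem _ _ h
  | mem x h =>
    obtain ⟨i, j, hi, hj, a, ha, b, hb, rfl⟩ := h
    rw [map_mul]
    exact Submodule.subset_span ⟨i, j, hi, hj, _, f.map_deg ha, _, f.map_deg hb, rfl⟩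

/-! ### Maps out of Hirsch extensions, and their low degrees -/

section Hirsch

open HirschCarrier

variable {M : CDGA.{u}} {k : ℕ} {V : Type u} [AddCommGroup V] [Module ℚ V]

namespace HirschCarrier

section LiftHom

variable {C : CDGA.{v}} (h : Hom M C) (φ : V →ₗ[ℚ] C) (hφ : ∀ v, φ v ∈ C.deg k)

/-- The algebra map out of `M⟨V⟩` determined by its values on `M` and on the generators. -/
def liftHom : HirschCarrier M k V →ₐ[ℚ] C :=
  lift h.toAlgHom φ (fun v w => C.graded_comm (hφ v) (hφ w))
    (fun _ _ ha v => C.graded_comm (h.map_deg ha) (hφ v))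

@[simp] theorem liftHom_inM (a : M) : liftHom h φ hφ (inM M k V a) = h a := lift_inM a

@[simp] theorem liftHom_inV (v : V) : liftHom h φ hφ (inV M k V v) = φ v := lift_inV v

theorem liftHom_mem {n : ℕ} {x : HirschCarrier M k V} (hx : x ∈ deg M k V n) :
    liftHom h φ hφ x ∈ C.deg n := by
  induction hx using Submodule.span_induction with
  | zero => rw [map_zero]; exact zero_mem _
  | add x x' _ _ h1 h2 => rw [map_add]; exact add_mem h1 h2
  | smul c x _ h => rw [map_smul]; exact Submodule.smul_mem _ _ h
  | mem x hx =>
    induction hx with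
    | one => rw [map_one]; exact C.one_mem_deg
    | mul e hg _ ih =>
      rw [map_mul, ← e]
      refine C.mul_mem_deg ?_ ih
      cases hg with
      | ofM ha => rw [liftHom_inM]; exact h.map_deg ha
      | ofV v => rw [liftHom_inV]; exact hφ v

/-- Both sides are derivations along the algebra map, so it suffices to compare them on generators,
where the claim is `hφd` or the compatibility of `h` with `d`. -/
theorem liftHom_diff (τ : V →ₗ[ℚ] M) (hτ : ∀ v, τ v ∈ M.deg (k + 1))
    (hφd : ∀ v, C.d (φ v) = h (τ v)) (x : HirschCarrier M k V) :
    liftHom h φ hφ (diff τ hτ x) = C.d (liftHom h φ hφ x) := by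
  induction x using mon_induction with
  | zero => simp
  | add x y hx hy => simp only [map_add, hx, hy]
  | smul c x hx => simp only [map_smul, hx]
  | mon n x hx =>
    induction hx with
    | one => rw [diff_one, map_zero, map_one, d_one]
    | mul e hg _ ih =>
      rw [diff_mul τ hτ hg.mem, map_add, map_mul, map_smul, map_mul, map_mul, ih]
      cases hg with
      | ofM ha => rw [diff_inM, liftHom_inM, liftHom_inM, h.map_d, C.leibniz (h.map_deg ha)]
      | ofV v => rw [diff_inV, liftHom_inM, liftHom_inV, ← hφd, C.leibniz (hφ v)]

end LiftHom

/-- Sending the generators to `0` is an algebra retraction. It need not commute with the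
differentials, so the argument stays at the level of algebras. -/
theorem inM_injective : Function.Injective (inM M k V) :=
  Function.LeftInverse.injective (g := liftHom (Hom.id M) 0 (fun _ => zero_mem _))
    (fun a => liftHom_inM _ _ _ a)

section Structure

/-- A generator already has degree `k`. In total degree `k` its cofactor is a scalar; in degree `k +
1` the cofactor has degree `1 < k`, hence lies in `M¹ = 0`. The three ranges are proved together
because stripping a factor lowers the degree into an earlier range. -/
theorem Mon.low (h0 : ∀ a ∈ M.deg 0, ∃ q, algebraMap ℚ M q = a) (h1 : ∀ a ∈ M.deg 1, a = 0)
    (hk : 2 ≤ k) {n : ℕ} {x : HirschCarrier M k V} (hx : Mon M k V n x) :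
    (n < k → x ∈ (M.deg n).map (inM M k V).toLinearMap) ∧
      (n = k → x ∈ (M.deg n).map (inM M k V).toLinearMap ⊔ LinearMap.range (inV M k V)) ∧
      (n = k + 1 → x ∈ (M.deg n).map (inM M k V).toLinearMap) := by
  induction hx with
  | one => exact ⟨fun _ => ⟨1, M.one_mem_deg, map_one (inM M k V)⟩, by omega, by omega⟩
  | @mul i n m g x e hg hx ih =>
    obtain ⟨ih1, ih2, ih3⟩ := ih
    cases hg with
    | @ofM i a ha =>
      have key : 0 < i → n < k → inM M k V a * x ∈ (M.deg m).map (inM M k V).toLinearMap := by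
        intro _ hn
        obtain ⟨b, hb, rfl⟩ := ih1 hn
        exact ⟨a * b, e ▸ M.mul_mem_deg ha hb, map_mul (inM M k V) a b⟩
      match i with
      | 0 =>
        obtain ⟨q, rfl⟩ := h0 a ha
        obtain rfl : n = m := by omega
        rw [AlgHom.commutes, ← Algebra.smul_def]
        exact ⟨fun h => Submodule.smul_mem _ _ (ih1 h), fun h => Submodule.smul_mem _ _ (ih2 h),
          fun h => Submodule.smul_mem _ _ (ih3 h)⟩
      | 1 =>
        rw [h1 a ha, map_zero, zero_mul]
        exact ⟨fun _ => zero_mem _, fun _ => zero_mem _, fun _ => zero_mem _⟩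
      -- A first factor of degree at least `2` in a monomial of degree at most `k + 1` leaves a
      -- cofactor of degree below `k`, which comes from `M`.
      | i + 2 =>
        exact ⟨fun h => key (by omega) (by omega),
          fun h => Submodule.mem_sup_left (key (by omega) (by omega)),
          fun h => key (by omega) (by omega)⟩
    | ofV v =>
      refine ⟨fun h => by omega, fun h => ?_, fun h => ?_⟩
      · obtain rfl : n = 0 := by omega
        obtain ⟨b, hb, rfl⟩ := ih1 (by omega)
        obtain ⟨q, rfl⟩ := h0 b hb
        refine Submodule.mem_sup_right ⟨q • v, ?_⟩
        rw [map_smul, AlgHom.toLinearMap_apply, AlgHom.commutes, ← Algebra.commutes,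
          Algebra.smul_def]
      · obtain rfl : n = 1 := by omega
        obtain ⟨b, hb, rfl⟩ := ih1 (by omega)
        rw [h1 b hb, map_zero, mul_zero]
        exact zero_mem _

theorem deg_le_of_lt (h0 : ∀ a ∈ M.deg 0, ∃ q, algebraMap ℚ M q = a)
    (h1 : ∀ a ∈ M.deg 1, a = 0) (hk : 2 ≤ k) {n : ℕ} (hn : n < k) :
    deg M k V n ≤ (M.deg n).map (inM M k V).toLinearMap :=
  Submodule.span_le.2 fun _ h => (h.low h0 h1 hk).1 hn

theorem deg_le_self (h0 : ∀ a ∈ M.deg 0, ∃ q, algebraMap ℚ M q = a)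
    (h1 : ∀ a ∈ M.deg 1, a = 0) (hk : 2 ≤ k) :
    deg M k V k ≤ (M.deg k).map (inM M k V).toLinearMap ⊔ LinearMap.range (inV M k V) :=
  Submodule.span_le.2 fun _ h => (h.low h0 h1 hk).2.1 rfl

theorem deg_le_succ (h0 : ∀ a ∈ M.deg 0, ∃ q, algebraMap ℚ M q = a)
    (h1 : ∀ a ∈ M.deg 1, a = 0) (hk : 2 ≤ k) :
    deg M k V (k + 1) ≤ (M.deg (k + 1)).map (inM M k V).toLinearMap :=
  Submodule.span_le.2 fun _ h => (h.low h0 h1 hk).2.2 rfl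

end Structure

end HirschCarrier

variable (τ : V →ₗ[ℚ] M) (hτ : ∀ v, τ v ∈ M.deg (k + 1)) (hd : ∀ v, M.d (τ v) = 0)

/-- The Hirsch extension `M⟨V⟩` of degree `k` with attaching map `τ`. -/
def hirsch : CDGA.{u} where
  carrier := HirschCarrier M k V
  deg := HirschCarrier.deg M k V
  d := diff τ hτ
  d_mem := diff_mem τ hτ
  d_d := diff_diff τ hτ hd
  leibniz := diff_mul τ hτ
  graded_comm := deg_comm

/-- The inclusion `M → M⟨V⟩`. -/
def hirschIncl : Hom M (hirsch τ hτ hd) where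
  toAlgHom := inM M k V
  map_deg h := (Gen.ofM h).mem
  map_d a := (diff_inM τ hτ a).symm

/-- The generators of `M⟨V⟩`. -/
def hirschGen : V →ₗ[ℚ] hirsch τ hτ hd := inV M k V

/-- The universal property of `M⟨V⟩`. -/
def hirschDesc {C : CDGA.{v}} (h : Hom M C) (φ : V →ₗ[ℚ] C) (hφ : ∀ v, φ v ∈ C.deg k)
    (hφd : ∀ v, C.d (φ v) = h (τ v)) : Hom (hirsch τ hτ hd) C where
  toAlgHom := liftHom h φ hφ
  map_deg hx := liftHom_mem h φ hφ hx
  map_d := liftHom_diff h φ hφ τ hτ hφd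

theorem hirsch_isHirschExtensionAlong :
    IsHirschExtensionAlong (hirschIncl τ hτ hd) k τ (hirschGen τ hτ hd) where
  attach_mem := hτ
  attach_d := hd
  gen_mem v := (Gen.ofV v).mem
  gen_d := diff_inV τ hτ
  desc C h φ hφ hφd := by
    refine ⟨hirschDesc τ hτ hd h φ hφ hφd, ⟨Hom.ext (liftHom_inM h φ hφ), liftHom_inV h φ hφ⟩, ?_⟩
    rintro e ⟨h1, h2⟩
    have key : e.toAlgHom = liftHom h φ hφ :=
      HirschCarrier.algHom_ext (M := M) (k := k) (V := V) (C := C)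
        (fun a => (Hom.congr h1 a).trans (liftHom_inM h φ hφ a).symm)
        (fun v => (h2 v).trans (liftHom_inV h φ hφ v).symm)
    exact Hom.ext fun x => AlgHom.congr_fun key x

theorem hirschIncl_injective : Function.Injective (hirschIncl τ hτ hd) := inM_injective

/-- If `M` has no indecomposables in degrees `> k`, then neither has `M⟨V⟩`. -/
theorem hirsch_decomposable (h0 : ∀ a ∈ M.deg 0, ∃ q, algebraMap ℚ M q = a)
    (h1 : ∀ a ∈ M.deg 1, a = 0) (hk : 2 ≤ k) (hM : ∀ n, k < n → M.deg n ≤ M.decomposables)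
    {n : ℕ} (hn : k < n) : (hirsch τ hτ hd).deg n ≤ (hirsch τ hτ hd).decomposables := by
  refine Submodule.span_le.2 fun x hx => ?_
  induction hx with
  | one => omega
  | @mul i n m g x e hg hx ih =>
    have key : 0 < i → 0 < n → (g * x : HirschCarrier M k V) ∈ (hirsch τ hτ hd).decomposables :=
      fun hi hn => Submodule.subset_span ⟨i, n, hi, hn, g, hg.mem, x, hx.mem, rfl⟩
    match n with
    | n + 1 =>
      match i with
      | i + 1 => exact key (Nat.succ_pos _) (Nat.succ_pos _)
      -- A factor of degree `0` is a scalar, so the product is a multiple of the shorter monomial.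
      | 0 =>
        obtain ⟨a, ha, rfl⟩ := deg_le_of_lt h0 h1 hk (by omega) hg.mem
        obtain ⟨q, rfl⟩ := h0 a ha
        have h2 : (inM M k V).toLinearMap (algebraMap ℚ M q) * x = q • x := by
          rw [AlgHom.toLinearMap_apply, AlgHom.commutes, ← Algebra.smul_def]
        rw [h2]
        exact Submodule.smul_mem (hirsch τ hτ hd).decomposables q (ih (by omega))
    | 0 =>
      obtain ⟨a, ha, rfl⟩ := deg_le_of_lt h0 h1 hk (by omega) hx.mem
      obtain ⟨q, rfl⟩ := h0 a ha
      have h2 : g * (inM M k V).toLinearMap (algebraMap ℚ M q) = q • g := by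
        rw [AlgHom.toLinearMap_apply, AlgHom.commutes, ← Algebra.commutes, ← Algebra.smul_def]
      rw [h2]
      refine Submodule.smul_mem (hirsch τ hτ hd).decomposables q ?_
      -- The cofactor is a scalar, so the factor itself has degree above `k`; it cannot be a new
      -- generator and comes from `M`.
      cases hg with
      | ofM hb => exact map_decomposables (hirschIncl τ hτ hd) (hM _ (by omega) hb)
      | ofV v => omega

end Hirsch

/-! ### Attaching the cohomology of the cone -/

/-- `m : M → A` is a `k`-minimal approximation of `A`: `M⁰ = ℚ`, `M¹ = 0`, `M` has no
indecomposables in degrees `> k`, and `m` is bijective on cohomology in degrees `≤ k` and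
injective in degree `k + 1`. -/
structure Hom.IsApprox {M A : CDGA.{u}} (m : Hom M A) (k : ℕ) : Prop where
  nontrivial : Nontrivial M
  deg_zero : ∀ a ∈ M.deg 0, ∃ q, algebraMap ℚ M q = a
  deg_one : ∀ a ∈ M.deg 1, a = 0
  decomposable : ∀ n, k < n → M.deg n ≤ M.decomposables
  inj : ∀ n ≤ k + 1, ∀ x ∈ M.deg n, M.d x = 0 → m x ∈ LinearMap.range A.d →
    x ∈ LinearMap.range M.d
  surj : ∀ n ≤ k, ∀ a ∈ A.deg n, A.d a = 0 →
    ∃ x ∈ M.deg n, M.d x = 0 ∧ m x - a ∈ LinearMap.range A.d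

section Attach

variable {M A : CDGA.{u}} (m : Hom M A) (k : ℕ)

theorem coneClass_eq_iff {z z' : ConeCocycles m k} :
    coneClass m k z = coneClass m k z' ↔ ((z : M × A) - z') ∈ LinearMap.range (coneD m) :=
  (Submodule.Quotient.eq _).trans Iff.rfl

/-- Over a field the projection from cocycles to cohomology splits. Linearity of the splitting is
needed for the attaching map and the values on generators to be linear in the class. -/
theorem exists_coneSection : ∃ s : ConeCohomology m k →ₗ[ℚ] ConeCocycles m k,
    coneClass m k ∘ₗ s = LinearMap.id :=
  LinearMap.exists_rightInverse_of_surjective _ (Submodule.range_mkQ _)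

/-- A linear choice of representatives of the classes in `H^k(C_m)`. -/
def coneSection : ConeCohomology m k →ₗ[ℚ] ConeCocycles m k :=
  Classical.choose (exists_coneSection m k)

theorem coneClass_coneSection (α : ConeCohomology m k) :
    coneClass m k (coneSection m k α) = α :=
  LinearMap.congr_fun (Classical.choose_spec (exists_coneSection m k)) α

/-- The attaching map `H^k(C_m) → M`. -/
def coneAttach : ConeCohomology m k →ₗ[ℚ] M :=
  LinearMap.fst ℚ M A ∘ₗ (ConeCocycles m k).subtype ∘ₗ coneSection m k

/-- The values in `A` of the generators attached along `H^k(C_m)`. -/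
def coneValue : ConeCohomology m k →ₗ[ℚ] A :=
  LinearMap.snd ℚ M A ∘ₗ (ConeCocycles m k).subtype ∘ₗ coneSection m k

theorem coneSection_coe (α : ConeCohomology m k) :
    (coneSection m k α : M × A) = (coneAttach m k α, coneValue m k α) := rfl

theorem coneAttach_mem (α : ConeCohomology m k) : coneAttach m k α ∈ M.deg (k + 1) :=
  (coneSection m k α).2.1.1

theorem coneValue_mem (α : ConeCohomology m k) : coneValue m k α ∈ A.deg k :=
  (coneSection m k α).2.1.2

theorem coneD_coneSection (α : ConeCohomology m k) :
    (M.d (coneAttach m k α), m (coneAttach m k α) - A.d (coneValue m k α)) = 0 :=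
  (coneSection m k α).2.2

theorem d_coneAttach (α : ConeCohomology m k) : M.d (coneAttach m k α) = 0 :=
  congrArg Prod.fst (coneD_coneSection m k α)

/-- The second component of the cocycle condition in the cone is exactly the compatibility required
to extend `m` over the new generator. -/
theorem d_coneValue (α : ConeCohomology m k) :
    A.d (coneValue m k α) = m (coneAttach m k α) :=
  (sub_eq_zero.1 (congrArg Prod.snd (coneD_coneSection m k α))).symm

/-- The extension `M⟨H^k C_m⟩`. -/
def coneExt : CDGA.{u} := hirsch (coneAttach m k) (coneAttach_mem m k) (d_coneAttach m k)

/-- The inclusion `M → M⟨H^k C_m⟩`. -/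
def coneExtIncl : Hom M (coneExt m k) := hirschIncl _ _ _

/-- The generators of `M⟨H^k C_m⟩`. -/
def coneExtGen : ConeCohomology m k →ₗ[ℚ] coneExt m k := hirschGen _ _ _

theorem coneExt_isHirsch : IsHirschExtensionAlong (coneExtIncl m k) k (coneAttach m k)
    (coneExtGen m k) := hirsch_isHirschExtensionAlong _ _ _

/-- The extension of `m` to `M⟨H^k C_m⟩`. -/
def coneExtHom : Hom (coneExt m k) A :=
  hirschDesc _ _ _ m (coneValue m k) (coneValue_mem m k) (d_coneValue m k)

@[simp] theorem coneExtHom_incl (a : M) : coneExtHom m k (coneExtIncl m k a) = m a :=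
  HirschCarrier.liftHom_inM m (coneValue m k) (coneValue_mem m k) a

@[simp] theorem coneExtHom_gen (α : ConeCohomology m k) :
    coneExtHom m k (coneExtGen m k α) = coneValue m k α :=
  HirschCarrier.liftHom_inV m (coneValue m k) (coneValue_mem m k) α

theorem coneExtIncl_injective : Function.Injective (coneExtIncl m k) :=
  hirschIncl_injective _ _ _

theorem d_coneExtGen (α : ConeCohomology m k) :
    (coneExt m k).d (coneExtGen m k α) = coneExtIncl m k (coneAttach m k α) :=
  (coneExt_isHirsch m k).gen_d α

variable {m k}

/-- The class of `z` vanishes in `H^k(C_m)` if its representative bounds. -/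
theorem eq_zero_of_mem_range {α : ConeCohomology m k}
    (h : (coneAttach m k α, coneValue m k α) ∈ LinearMap.range (coneD m)) : α = 0 := by
  rw [← coneClass_coneSection m k α, ← map_zero (coneClass m k), coneClass_eq_iff]
  simpa [coneSection_coe] using h

/-- A cocycle is cohomologous to the chosen representative of its class. -/
theorem exists_coneAttach_sub {x : M} (hx : x ∈ M.deg (k + 2)) (hdx : M.d x = 0) {a : A}
    (ha : a ∈ A.deg (k + 1)) (hda : A.d a = m x) :
    ∃ (α : ConeCohomology m (k + 1)), ∃ w ∈ M.deg (k + 1), ∃ b : A,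
      M.d w = coneAttach m (k + 1) α - x ∧ m w - A.d b = coneValue m (k + 1) α - a := by
  have hz : (x, a) ∈ ConeCocycles m (k + 1) :=
    ⟨⟨hx, ha⟩, Prod.ext hdx (sub_eq_zero.2 hda.symm)⟩
  obtain ⟨⟨w, b⟩, hw, h⟩ := (mem_range_coneD_iff m
    (sub_mem (coneSection m (k + 1) _).2.1 hz.1)).1 ((coneClass_eq_iff m (k + 1)).1
      (coneClass_coneSection m (k + 1) (coneClass m (k + 1) ⟨(x, a), hz⟩)))
  exact ⟨_, w, hw.1, b, congrArg Prod.fst h, congrArg Prod.snd h⟩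

/-- Below degree `k + 1` nothing changes. In degree `k + 1` the new generators supply the cokernel
without creating a kernel, because a nonzero class `α` has a representative that does not bound. In
degree `k + 2` no elements are added, and cocycles that die in `A` are now bounded by generators. -/
theorem Hom.IsApprox.coneExt (hk : 1 ≤ k) (h : m.IsApprox k) :
    (coneExtHom m (k + 1)).IsApprox (k + 1) := by
  have := h.nontrivial
  have hlt : ∀ n < k + 1, ∀ x ∈ (CDGA.coneExt m (k + 1)).deg n,
      ∃ a ∈ M.deg n, coneExtIncl m (k + 1) a = x := fun n hn x hx =>
    HirschCarrier.deg_le_of_lt h.deg_zero h.deg_one (by omega) hn hx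
  have hself : ∀ x ∈ (CDGA.coneExt m (k + 1)).deg (k + 1), ∃ a ∈ M.deg (k + 1), ∃ α,
      coneExtIncl m (k + 1) a + coneExtGen m (k + 1) α = x := fun x hx => by
    obtain ⟨y, ⟨a, ha, rfl⟩, z, ⟨α, rfl⟩, rfl⟩ := Submodule.mem_sup.1
      (HirschCarrier.deg_le_self h.deg_zero h.deg_one (by omega) hx)
    exact ⟨a, ha, α, rfl⟩
  have hsucc : ∀ x ∈ (CDGA.coneExt m (k + 1)).deg (k + 2),
      ∃ a ∈ M.deg (k + 2), coneExtIncl m (k + 1) a = x := fun x hx =>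
    HirschCarrier.deg_le_succ h.deg_zero h.deg_one (by omega) hx
  have hinj := coneExtIncl_injective m (k + 1)
  have hcocycle : ∀ a, (CDGA.coneExt m (k + 1)).d (coneExtIncl m (k + 1) a) = 0 → M.d a = 0 :=
    fun a ha => hinj (by rw [Hom.map_d, ha, map_zero])
  have hlow : ∀ n ≤ k + 1, ∀ a ∈ M.deg n,
      (CDGA.coneExt m (k + 1)).d (coneExtIncl m (k + 1) a) = 0 → m a ∈ LinearMap.range A.d →
      coneExtIncl m (k + 1) a ∈ LinearMap.range (CDGA.coneExt m (k + 1)).d := by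
    intro n hn a ha hda hma
    obtain ⟨y, rfl⟩ := h.inj n hn a ha (hcocycle a hda) hma
    exact ⟨coneExtIncl m (k + 1) y, (Hom.map_d _ _).symm⟩
  refine ⟨hinj.nontrivial, fun x hx => ?_, fun x hx => ?_, fun n hn => ?_, ?_, ?_⟩
  · obtain ⟨a, ha, rfl⟩ := hlt 0 (by omega) x hx
    obtain ⟨q, rfl⟩ := h.deg_zero a ha
    exact ⟨q, ((coneExtIncl m (k + 1)).toAlgHom.commutes q).symm⟩
  · obtain ⟨a, ha, rfl⟩ := hlt 1 (by omega) x hx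
    rw [h.deg_one a ha, map_zero]
  · exact hirsch_decomposable _ _ _ h.deg_zero h.deg_one (by omega)
      (fun n hn => h.decomposable n (by omega)) hn
  · intro n hn x hx hdx hmx
    rcases lt_trichotomy n (k + 1) with hn' | rfl | hn'
    · obtain ⟨a, ha, rfl⟩ := hlt n hn' x hx
      rw [coneExtHom_incl] at hmx
      exact hlow n (by omega) a ha hdx hmx
    · obtain ⟨a, ha, α, rfl⟩ := hself x hx
      rw [map_add, d_coneExtGen, ← Hom.map_d, ← map_add] at hdx
      have hdx' : M.d a + coneAttach m (k + 1) α = 0 := hinj (by rw [hdx, map_zero])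
      obtain ⟨b, hb⟩ := hmx
      rw [map_add, coneExtHom_incl, coneExtHom_gen] at hb
      -- From `da + τ α = 0` and `db = m(a) + value(α)`, the cone differential of `(-a, -b)` is the
      -- chosen representative of `α`. Hence no new generator can occur in a cocycle whose image
      -- bounds.
      have hα : α = 0 := eq_zero_of_mem_range ⟨(-a, -b), by
        rw [coneD_apply, map_neg, map_neg, map_neg, hb]
        refine Prod.ext ?_ ?_
        · exact neg_eq_of_add_eq_zero_right hdx'
        · simp⟩
      subst hα
      rw [map_zero, add_zero]
      rw [map_zero, add_zero] at hdx' hb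
      refine hlow (k + 1) le_rfl a ha ?_ ⟨b, hb⟩
      rw [← Hom.map_d, hdx', map_zero]
    -- The cocycle comes from some `a` in `M`, and with `m(a) = db` the pair `(a, b)` is a cone
    -- cocycle. The generator of its class, corrected by `w`, has differential `a`.
    · obtain rfl : n = k + 2 := by omega
      obtain ⟨a, ha, rfl⟩ := hsucc x hx
      rw [coneExtHom_incl] at hmx
      obtain ⟨b, hb, hdb⟩ := (A.mem_range_d_iff (m.map_deg ha)).1 hmx
      obtain ⟨α, w, _, _, hw, _⟩ := exists_coneAttach_sub ha (hcocycle a hdx) hb hdb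
      refine ⟨coneExtGen m (k + 1) α - coneExtIncl m (k + 1) w, ?_⟩
      rw [map_sub, d_coneExtGen, ← Hom.map_d, hw, ← map_sub, sub_sub_cancel]
  · intro n hn a ha hda
    rcases hn.lt_or_eq with hn' | rfl
    · obtain ⟨x, hx, hdx, hmx⟩ := h.surj n (by omega) a ha hda
      refine ⟨coneExtIncl m (k + 1) x, Hom.map_deg _ hx, ?_, ?_⟩
      · rw [← Hom.map_d, hdx, map_zero]
      · rwa [coneExtHom_incl]
    -- The cocycle `a` of `A` gives the cone cocycle `(0, a)`. Its chosen representative differs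
    -- from it by the coboundary of `(w, b)`, so the generator minus `w` is closed and maps to `a -
    -- db`.
    · obtain ⟨α, w, hw, b, hdw, hb⟩ := exists_coneAttach_sub (m := m) (k := k) (zero_mem _)
        (map_zero _) ha (by rw [hda, map_zero])
      rw [sub_zero] at hdw
      refine ⟨coneExtGen m (k + 1) α - coneExtIncl m (k + 1) w,
        sub_mem ((coneExt_isHirsch m (k + 1)).gen_mem α) (Hom.map_deg _ hw), ?_, ⟨-b, ?_⟩⟩
      · rw [map_sub, d_coneExtGen, ← Hom.map_d, hdw, sub_self]
      · rw [map_sub, coneExtHom_incl, coneExtHom_gen, map_neg, sub_right_comm, ← hb,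
          sub_sub_cancel_left]

end Attach

section Desc

variable {M A : CDGA.{u}} (m : Hom M A) (k : ℕ) {C : CDGA.{u}}

/-- Homomorphisms out of `M⟨H^k C_m⟩`. -/
def coneExtDesc (h : Hom M C) (φ : ConeCohomology m k →ₗ[ℚ] C) (hφ : ∀ α, φ α ∈ C.deg k)
    (hφd : ∀ α, C.d (φ α) = h (coneAttach m k α)) : Hom (coneExt m k) C :=
  hirschDesc _ _ _ h φ hφ hφd

variable {m k} {h : Hom M C} {φ : ConeCohomology m k →ₗ[ℚ] C} {hφ : ∀ α, φ α ∈ C.deg k}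
    {hφd : ∀ α, C.d (φ α) = h (coneAttach m k α)}

@[simp] theorem coneExtDesc_incl (a : M) :
    coneExtDesc m k h φ hφ hφd (coneExtIncl m k a) = h a :=
  HirschCarrier.liftHom_inM h φ hφ a

@[simp] theorem coneExtDesc_gen (α : ConeCohomology m k) :
    coneExtDesc m k h φ hφ hφd (coneExtGen m k α) = φ α :=
  HirschCarrier.liftHom_inV h φ hφ α

theorem coneExt_hom_ext {e e' : Hom (coneExt m k) C}
    (h1 : ∀ a, e (coneExtIncl m k a) = e' (coneExtIncl m k a))
    (h2 : ∀ α, e (coneExtGen m k α) = e' (coneExtGen m k α)) : e = e' :=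
  ((coneExt_isHirsch m k).desc C (e'.comp (coneExtIncl m k)) (e'.lin ∘ₗ coneExtGen m k)
    (fun α => e'.map_deg ((coneExt_isHirsch m k).gen_mem α))
    (fun α => by
      rw [LinearMap.comp_apply, Hom.lin_apply, ← Hom.map_d, d_coneExtGen, Hom.comp_apply])).unique
    ⟨Hom.ext h1, h2⟩ ⟨rfl, fun _ => rfl⟩

end Desc

/-! ### Extending a square over the attached cones -/

section Square

variable {A B : CDGA.{u}} {f : Hom A B} (S : MapSquare f) (k : ℕ)

/-- The image under the cone map of the representative of `α` and the representative of the image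
class are cohomologous. A linear section of the cone differential onto its range makes the bounding
element `W α` linear in `α`. -/
theorem MapSquare.exists_coneLift : ∃ W : ConeCohomology S.m (k + 1) →ₗ[ℚ] S.N × B,
    (∀ α, W α ∈ coneDeg S.n k) ∧ ∀ α, coneD S.n (W α) =
      S.coneMap (coneAttach S.m (k + 1) α, coneValue S.m (k + 1) α) -
        (coneAttach S.n (k + 1) (S.coneCohomologyMap (k + 1) α),
          coneValue S.n (k + 1) (S.coneCohomologyMap (k + 1) α)) := by
  let L : ConeCohomology S.m (k + 1) →ₗ[ℚ] S.N × B :=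
    S.coneMap ∘ₗ (ConeCocycles S.m (k + 1)).subtype ∘ₗ coneSection S.m (k + 1) -
      (ConeCocycles S.n (k + 1)).subtype ∘ₗ coneSection S.n (k + 1) ∘ₗ
        S.coneCohomologyMap (k + 1)
  -- Restricting the cone differential to degree `k` before choosing a section forces the bounding
  -- elements to be homogeneous.
  let D : coneDeg S.n k →ₗ[ℚ] S.N × B := coneD S.n ∘ₗ (coneDeg S.n k).subtype
  have hL : ∀ α, L α ∈ LinearMap.range D := by
    intro α
    let z := coneSection S.m (k + 1) α
    have hz : S.coneMap z ∈ ConeCocycles S.n (k + 1) :=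
      ⟨S.coneMap_mem _ _ z.2.1, by
        have h : coneD S.m z = 0 := z.2.2
        change coneD S.n (S.coneMap z) = 0
        rw [← S.coneMap_coneD, h, map_zero]⟩
    have hcl : coneClass S.n (k + 1) ⟨S.coneMap z, hz⟩ = S.coneCohomologyMap (k + 1) α := by
      conv_rhs => rw [← coneClass_coneSection S.m (k + 1) α]
      rfl
    rw [← coneClass_coneSection S.n (k + 1) (S.coneCohomologyMap (k + 1) α),
      coneClass_eq_iff] at hcl
    obtain ⟨y, hy, h⟩ := (mem_range_coneD_iff S.n
      (sub_mem hz.1 (coneSection S.n (k + 1) _).2.1)).1 hcl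
    exact ⟨⟨y, hy⟩, h⟩
  obtain ⟨r, hr⟩ := LinearMap.exists_rightInverse_of_surjective D.rangeRestrict
    (LinearMap.range_rangeRestrict D)
  refine ⟨(coneDeg S.n k).subtype ∘ₗ r ∘ₗ L.codRestrict _ hL,
    fun α => (r (L.codRestrict _ hL α)).2, fun α => ?_⟩
  exact congrArg Subtype.val (LinearMap.congr_fun hr (L.codRestrict _ hL α))

/-- The square obtained by attaching the cohomology of the cones. -/
theorem MapSquare.exists_coneExtension (hk : 1 ≤ k) (hM : S.m.IsApprox k)
    (hN : S.n.IsApprox k) :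
    ∃ (S' : MapSquare f) (E : S.ConeExtension (k + 1) S'), S'.m.IsApprox (k + 1) ∧
      S'.n.IsApprox (k + 1) ∧ Function.Injective E.i ∧ Function.Injective E.j := by
  obtain ⟨W, hW, hWd⟩ := S.exists_coneLift k
  have hW1 : ∀ α, S.N.d (W α).1 = S.g (coneAttach S.m (k + 1) α) -
      coneAttach S.n (k + 1) (S.coneCohomologyMap (k + 1) α) :=
    fun α => congrArg Prod.fst (hWd α)
  have hW2 : ∀ α, S.n (W α).1 - B.d (W α).2 = f (coneValue S.m (k + 1) α) +
      S.H.integral (coneAttach S.m (k + 1) α) -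
        coneValue S.n (k + 1) (S.coneCohomologyMap (k + 1) α) :=
    fun α => congrArg Prod.snd (hWd α)
  -- The first component of `W α` repairs the differential: by `hW1`, adding it to the generator of
  -- the image class gives an element whose differential is `g` of the attaching cocycle.
  let γ : ConeCohomology S.m (k + 1) →ₗ[ℚ] coneExt S.n (k + 1) :=
    coneExtGen S.n (k + 1) ∘ₗ S.coneCohomologyMap (k + 1) +
      (coneExtIncl S.n (k + 1)).lin ∘ₗ LinearMap.fst ℚ _ _ ∘ₗ W
  have hγ : ∀ α, γ α = coneExtGen S.n (k + 1) (S.coneCohomologyMap (k + 1) α) +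
      coneExtIncl S.n (k + 1) (W α).1 := fun α => rfl
  let g' : Hom (coneExt S.m (k + 1)) (coneExt S.n (k + 1)) :=
    coneExtDesc S.m (k + 1) ((coneExtIncl S.n (k + 1)).comp S.g) γ
      (fun α => by
        rw [hγ]
        exact add_mem ((coneExt_isHirsch S.n (k + 1)).gen_mem _)
          ((coneExtIncl S.n (k + 1)).map_deg (hW α).1))
      (fun α => by
        rw [hγ, map_add, d_coneExtGen, ← Hom.map_d, hW1, ← map_add, add_sub_cancel,
          Hom.comp_apply])
  let X : ConeCohomology S.m (k + 1) →ₗ[ℚ] TensorCarrier B interval :=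
    S.H.toHom.lin ∘ₗ coneAttach S.m (k + 1)
  -- The path starts at `f` of the value of `α` and has differential `H` of the attaching cocycle.
  -- Its end is `f(value) + ∫₀¹ H + d(W α).2`, which by `hW2` is the image under the extended `n` of
  -- `γ α`.
  let Y : ConeCohomology S.m (k + 1) →ₗ[ℚ] tensor B interval :=
    pathLift B ∘ₗ X.prod ((f.lin ∘ₗ coneValue S.m (k + 1)).prod (LinearMap.snd ℚ _ _ ∘ₗ W))
  have hY : ∀ α, Y α = pathLift B (S.H.toHom (coneAttach S.m (k + 1) α),
      f (coneValue S.m (k + 1) α), (W α).2) := fun α => rfl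
  let H' : Hom (coneExt S.m (k + 1)) (tensor B interval) :=
    coneExtDesc S.m (k + 1) S.H.toHom Y
      (fun α => by
        rw [hY]
        exact pathLift_mem (S.H.toHom.map_deg (coneAttach_mem S.m (k + 1) α))
          (f.map_deg (coneValue_mem S.m (k + 1) α)) (hW α).2)
      (fun α => by
        rw [hY]
        refine d_pathLift ?_ ?_
        · rw [← Hom.map_d, d_coneAttach, map_zero]
        · rw [← Hom.map_d, d_coneValue, S.H.eval_zero, Hom.comp_apply])
  have h_zero : (evalHom B 0).comp H' = f.comp (coneExtHom S.m (k + 1)) := by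
    refine coneExt_hom_ext (fun a => ?_) (fun α => ?_)
    · rw [Hom.comp_apply, Hom.comp_apply, coneExtDesc_incl, coneExtHom_incl, evalHom_apply,
        S.H.eval_zero, Hom.comp_apply]
    · rw [Hom.comp_apply, Hom.comp_apply, coneExtDesc_gen, coneExtHom_gen, evalHom_apply, hY,
        evalAt_zero_pathLift]
  have h_one : (evalHom B 1).comp H' = (coneExtHom S.n (k + 1)).comp g' := by
    refine coneExt_hom_ext (fun a => ?_) (fun α => ?_)
    · rw [Hom.comp_apply, Hom.comp_apply, coneExtDesc_incl, coneExtDesc_incl, Hom.comp_apply,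
        coneExtHom_incl, evalHom_apply, S.H.eval_one, Hom.comp_apply]
    · rw [Hom.comp_apply, Hom.comp_apply, coneExtDesc_gen, coneExtDesc_gen, evalHom_apply, hY,
        evalAt_one_pathLift, hγ, map_add, coneExtHom_gen, coneExtHom_incl,
        ← sub_add_cancel (S.n (W α).1) (B.d (W α).2), hW2]
      change S.H.integral _ + _ + _ = _
      abel
  have h_top : g'.comp (coneExtIncl S.m (k + 1)) = (coneExtIncl S.n (k + 1)).comp S.g :=
    Hom.ext fun a => by rw [Hom.comp_apply, coneExtDesc_incl]
  have h_homotopy : H'.comp (coneExtIncl S.m (k + 1)) = S.H.toHom :=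
    Hom.ext fun a => by rw [Hom.comp_apply, coneExtDesc_incl]
  let S' : MapSquare f :=
    { M := coneExt S.m (k + 1)
      N := coneExt S.n (k + 1)
      g := g'
      m := coneExtHom S.m (k + 1)
      n := coneExtHom S.n (k + 1)
      H := ⟨H', Hom.congr h_zero, Hom.congr h_one⟩ }
  let E : S.ConeExtension (k + 1) S' :=
    { i := coneExtIncl S.m (k + 1)
      j := coneExtIncl S.n (k + 1)
      top_comm := h_top
      left_comm := Hom.ext fun a => coneExtHom_incl S.m (k + 1) a
      right_comm := Hom.ext fun a => coneExtHom_incl S.n (k + 1) a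
      homotopy_comm := h_homotopy
      attachM := coneAttach S.m (k + 1)
      genM := coneExtGen S.m (k + 1)
      hirschM := coneExt_isHirsch S.m (k + 1)
      reprM := fun α => ⟨coneSection S.m (k + 1) α,
        Prod.ext rfl (coneExtHom_gen S.m (k + 1) α).symm, coneClass_coneSection S.m (k + 1) α⟩
      attachN := coneAttach S.n (k + 1)
      genN := coneExtGen S.n (k + 1)
      hirschN := coneExt_isHirsch S.n (k + 1)
      reprN := fun α => ⟨coneSection S.n (k + 1) α,
        Prod.ext rfl (coneExtHom_gen S.n (k + 1) α).symm, coneClass_coneSection S.n (k + 1) α⟩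
      linear_part := fun α => by
        have h : g' (coneExtGen S.m (k + 1) α) -
            coneExtGen S.n (k + 1) (S.coneCohomologyMap (k + 1) α) =
            coneExtIncl S.n (k + 1) (W α).1 := by
          rw [coneExtDesc_gen, hγ, add_sub_cancel_left]
        change g' (coneExtGen S.m (k + 1) α) -
            coneExtGen S.n (k + 1) (S.coneCohomologyMap (k + 1) α) ∈ _
        rw [h]
        -- The correction `(W α).1` lies in degree `k + 1` of `N`, one above the last degree with
        -- generators.
        exact map_decomposables _ (hN.decomposable _ (Nat.lt_succ_self k) (hW α).1) }
  exact ⟨S', E, hM.coneExt hk, hN.coneExt hk, coneExtIncl_injective _ _, coneExtIncl_injective _ _⟩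

end Square

/-! ### Sequential colimits -/

section Colimit

variable {F : ℕ → CDGA.{u}} (step : ∀ n, Hom (F n) (F (n + 1)))

/-- The transition maps of a sequence of CDGAs. -/
def trans {i j : ℕ} (h : i ≤ j) : Hom (F i) (F j) :=
  Nat.leRec (motive := fun j _ => Hom (F i) (F j)) (Hom.id (F i))
    (fun j _ e => (step j).comp e) h

theorem trans_self (i : ℕ) : trans step (le_refl i) = Hom.id (F i) := Nat.leRec_self _ _

theorem trans_succ {i j : ℕ} (h : i ≤ j) (h' : i ≤ j + 1) :
    trans step h' = (step j).comp (trans step h) := Nat.leRec_succ _ _ h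

theorem trans_step (i : ℕ) (h : i ≤ i + 1) : trans step h = step i := by
  rw [trans_succ step (le_refl i) h, trans_self]
  rfl

theorem trans_comp {i j k : ℕ} (h : i ≤ j) (h' : j ≤ k) (h'' : i ≤ k) :
    (trans step h').comp (trans step h) = trans step h'' := by
  induction k, h' using Nat.le_induction with
  | base => rw [trans_self]; rfl
  | succ k h' ih =>
    rw [trans_succ step h', trans_succ step (h.trans h') h'', ← ih (h.trans h')]
    rfl

theorem trans_injective (hinj : ∀ n, Function.Injective (step n)) {i j : ℕ} (h : i ≤ j) :
    Function.Injective (trans step h) := by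
  induction j, h using Nat.le_induction with
  | base => rw [trans_self]; exact fun _ _ h => h
  | succ k h ih =>
    rw [trans_succ step h]
    exact (hinj k).comp ih

/-- The transition maps as algebra homomorphisms. -/
def transAlg (i j : ℕ) (h : i ≤ j) : F i →ₐ[ℚ] F j := (trans step h).toAlgHom

instance transAlg_directedSystem :
    DirectedSystem (fun i => (F i : Type u)) (fun i j h => transAlg step i j h) where
  map_self i x := Hom.congr (trans_self step i) x
  map_map _ _ _ h h' x := Hom.congr (trans_comp step h h' (h.trans h')) x

/-- The underlying algebra of the colimit. -/
abbrev ColimCarrier : Type u := DirectLimit (fun i => (F i : Type u)) (transAlg step)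

instance colimAlgebra : Algebra ℚ (ColimCarrier step) :=
  Algebra.ofModule (fun _ _ _ => smul_mul_assoc _ _ _) (fun _ _ _ => mul_smul_comm _ _ _)

namespace ColimCarrier

/-- The inclusions into the colimit. -/
def incl (i : ℕ) : F i →ₐ[ℚ] ColimCarrier step :=
  AlgHom.ofLinearMap
    { toFun := fun x => ⟦⟨i, x⟩⟧
      map_add' := fun x y => by
        change (⟦⟨i, x + y⟩⟧ : ColimCarrier step) = ⟦⟨i, x⟩⟧ + ⟦⟨i, y⟩⟧
        rw [DirectLimit.add_def]
      map_smul' := fun c x => by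
        change (⟦⟨i, c • x⟩⟧ : ColimCarrier step) = c • ⟦⟨i, x⟩⟧
        rw [DirectLimit.smul_def] }
    (by
      change (⟦⟨i, 1⟩⟧ : ColimCarrier step) = 1
      rw [DirectLimit.one_def i])
    (fun x y => by
      change (⟦⟨i, x * y⟩⟧ : ColimCarrier step) = ⟦⟨i, x⟩⟧ * ⟦⟨i, y⟩⟧
      rw [DirectLimit.mul_def])

variable {step}

theorem incl_trans {i j : ℕ} (h : i ≤ j) (x : F i) :
    incl step j (trans step h x) = incl step i x := by
  change (⟦⟨j, transAlg step i j h x⟩⟧ : ColimCarrier step) = ⟦⟨i, x⟩⟧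
  rw [DirectLimit.mk_apply]

theorem exists_incl (x : ColimCarrier step) : ∃ i a, incl step i a = x := by
  obtain ⟨i, a, rfl⟩ := DirectLimit.exists_eq_mk (f := transAlg step) x
  exact ⟨i, a, rfl⟩

/-- Linear maps out of the colimit. -/
def liftLin {P : Type*} [AddCommGroup P] [Module ℚ P] (g : ∀ i, F i →ₗ[ℚ] P)
    (hg : ∀ i x, g (i + 1) (step i x) = g i x) : ColimCarrier step →ₗ[ℚ] P :=
  have hg' : ∀ i j (h : i ≤ j) x, g i x = g j (transAlg step i j h x) := by
    intro i j h x
    induction j, h using Nat.le_induction with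
    | base => exact (congrArg (g i) (Hom.congr (trans_self step i) x)).symm
    | succ k h ih =>
      rw [ih, ← hg]
      exact (congrArg (g (k + 1)) (Hom.congr (trans_succ step h (by omega)) x)).symm
  { toFun := DirectLimit.lift (transAlg step) (fun i x => g i x) hg'
    map_add' := fun x y => by
      obtain ⟨i, a, b, rfl, rfl⟩ := DirectLimit.exists_eq_mk₂ (f := transAlg step) x y
      rw [DirectLimit.add_def]
      exact map_add (g i) a b
    map_smul' := fun c x => by
      obtain ⟨i, a, rfl⟩ := DirectLimit.exists_eq_mk (f := transAlg step) x
      rw [DirectLimit.smul_def]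
      exact map_smul (g i) c a }

theorem incl_step (i : ℕ) (x : F i) : incl step (i + 1) (step i x) = incl step i x := by
  rw [← trans_step step i (by omega), incl_trans]

theorem exists_incl₂ (x y : ColimCarrier step) :
    ∃ i a b, incl step i a = x ∧ incl step i b = y := by
  obtain ⟨i, a, b, rfl, rfl⟩ := DirectLimit.exists_eq_mk₂ (f := transAlg step) x y
  exact ⟨i, a, b, rfl, rfl⟩

/-- Algebra maps out of the colimit. -/
def liftAlg {P : Type*} [Ring P] [Algebra ℚ P] (g : ∀ i, F i →ₐ[ℚ] P)
    (hg : ∀ i x, g (i + 1) (step i x) = g i x) : ColimCarrier step →ₐ[ℚ] P :=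
  AlgHom.ofLinearMap (liftLin (fun i => (g i).toLinearMap) hg)
    (by
      rw [← map_one (incl step 0)]
      exact map_one (g 0))
    (fun x y => by
      obtain ⟨i, a, b, rfl, rfl⟩ := exists_incl₂ x y
      rw [← map_mul]
      exact map_mul (g i) a b)

variable (step) in
/-- The homogeneous parts of the colimit. -/
def deg (n : ℕ) : Submodule ℚ (ColimCarrier step) where
  carrier := {x | ∃ i, ∃ a ∈ (F i).deg n, incl step i a = x}
  zero_mem' := ⟨0, 0, zero_mem _, map_zero _⟩
  add_mem' := by
    rintro _ _ ⟨i, a, ha, rfl⟩ ⟨j, b, hb, rfl⟩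
    refine ⟨max i j, trans step (le_max_left i j) a + trans step (le_max_right i j) b,
      add_mem (Hom.map_deg _ ha) (Hom.map_deg _ hb), ?_⟩
    rw [map_add, incl_trans, incl_trans]
  smul_mem' := by
    rintro c _ ⟨i, a, ha, rfl⟩
    exact ⟨i, c • a, Submodule.smul_mem _ _ ha, map_smul _ _ _⟩

theorem incl_mem {i n : ℕ} {a : F i} (ha : a ∈ (F i).deg n) : incl step i a ∈ deg step n :=
  ⟨i, a, ha, rfl⟩

theorem mul_mem {m n : ℕ} {x y : ColimCarrier step} (hx : x ∈ deg step m)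
    (hy : y ∈ deg step n) : x * y ∈ deg step (m + n) := by
  obtain ⟨i, a, ha, rfl⟩ := hx
  obtain ⟨j, b, hb, rfl⟩ := hy
  rw [← incl_trans (le_max_left i j), ← incl_trans (le_max_right i j) b, ← map_mul]
  exact incl_mem (mul_mem_deg _ (Hom.map_deg _ ha) (Hom.map_deg _ hb))

/-- The projection of a CDGA onto its part of degree `n`. -/
def _root_.CDGA.projDeg (A : CDGA.{u}) (n : ℕ) : A →ₗ[ℚ] A where
  toFun a := DirectSum.decompose A.deg a n
  map_add' a b := by simp
  map_smul' c a := by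
    rw [DirectSum.decompose_smul]
    rfl

variable (step) in
/-- The projections of the colimit onto its homogeneous parts. -/
def proj (n : ℕ) : ColimCarrier step →ₗ[ℚ] ColimCarrier step :=
  liftLin (fun i => (incl step i).toLinearMap ∘ₗ (F i).projDeg n) (fun i x => by
    have h : (F (i + 1)).projDeg n (step i x) = step i ((F i).projDeg n x) :=
      decompose_hom (step i) x n
    simp only [LinearMap.comp_apply, AlgHom.toLinearMap_apply, h, incl_step])

theorem proj_incl (n i : ℕ) (a : F i) :
    proj step n (incl step i a) = incl step i (DirectSum.decompose (F i).deg a n) := rfl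

/-- The transition maps preserve degrees, so the projections of the stages pass to the colimit and
separate its homogeneous parts. -/
instance decomposition : DirectSum.Decomposition (deg step) :=
  decompositionOfProj _ (proj step)
    (by
      rintro n _ ⟨i, a, ha, rfl⟩
      rw [proj_incl, DirectSum.decompose_of_mem_same _ ha])
    (by
      rintro m n h _ ⟨i, a, ha, rfl⟩
      rw [proj_incl, DirectSum.decompose_of_mem_ne _ ha h, map_zero])
    (by
      refine eq_top_iff.2 fun x _ => ?_
      obtain ⟨i, a, rfl⟩ := exists_incl x
      induction a using DirectSum.Decomposition.inductionOn (F i).deg with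
      | zero => rw [map_zero]; exact zero_mem _
      | add x y hx hy => rw [map_add]; exact add_mem (hx trivial) (hy trivial)
      | homogeneous x => exact Submodule.mem_iSup_of_mem _ (incl_mem x.2))

instance gradedAlgebra : GradedAlgebra (deg step) where
  one_mem := ⟨0, 1, one_mem_deg _, map_one _⟩
  mul_mem _ _ _ _ hx hy := mul_mem hx hy

variable (step) in
/-- The differential of the colimit. -/
def diff : ColimCarrier step →ₗ[ℚ] ColimCarrier step :=
  liftLin (fun i => (incl step i).toLinearMap ∘ₗ (F i).d) (fun i x => by
    simp only [LinearMap.comp_apply, AlgHom.toLinearMap_apply, ← Hom.map_d, incl_step])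

theorem diff_incl (i : ℕ) (a : F i) : diff step (incl step i a) = incl step i ((F i).d a) := rfl

end ColimCarrier

open ColimCarrier

/-- The colimit of a sequence of CDGAs. -/
def colim : CDGA.{u} where
  carrier := ColimCarrier step
  deg := ColimCarrier.deg step
  d := diff step
  d_mem := by
    rintro n _ ⟨i, a, ha, rfl⟩
    exact incl_mem ((F i).d_mem ha)
  d_d x := by
    obtain ⟨i, a, rfl⟩ := exists_incl x
    rw [diff_incl, diff_incl, (F i).d_d, map_zero]
  leibniz := by
    rintro n _ ⟨i, a, ha, rfl⟩ y
    obtain ⟨j, b, rfl⟩ := exists_incl y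
    rw [← incl_trans (le_max_left i j) a, ← incl_trans (le_max_right i j) b, ← map_mul,
      diff_incl, leibniz _ (Hom.map_deg _ ha), diff_incl, diff_incl, map_add, map_mul, map_smul,
      map_mul]
  graded_comm := by
    rintro m n _ _ ⟨i, a, ha, rfl⟩ ⟨j, b, hb, rfl⟩
    rw [← incl_trans (le_max_left i j) a, ← incl_trans (le_max_right i j) b, ← map_mul,
      graded_comm _ (Hom.map_deg _ ha) (Hom.map_deg _ hb), map_smul, map_mul]

/-- The inclusions into the colimit. -/
def colimIncl (i : ℕ) : Hom (F i) (colim step) where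
  toAlgHom := ColimCarrier.incl step i
  map_deg h := incl_mem h
  map_d _ := rfl

theorem exists_colimIncl (x : colim step) : ∃ i a, colimIncl step i a = x := exists_incl x

theorem exists_colimIncl_of_mem {n : ℕ} {x : colim step} (hx : x ∈ (colim step).deg n) :
    ∃ i, ∃ a ∈ (F i).deg n, colimIncl step i a = x := hx

theorem colimIncl_comp_step (i : ℕ) :
    (colimIncl step (i + 1)).comp (step i) = colimIncl step i := Hom.ext (incl_step i)

theorem colimIncl_comp_trans {i j : ℕ} (h : i ≤ j) :
    (colimIncl step j).comp (trans step h) = colimIncl step i := Hom.ext (incl_trans h)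

theorem colimIncl_injective (hinj : ∀ n, Function.Injective (step n)) (i : ℕ) :
    Function.Injective (colimIncl step i) :=
  DirectLimit.mk_injective (transAlg step) (fun _ _ h => trans_injective step hinj h) i

variable {step}

theorem colim_hom_ext {C : CDGA.{v}} {e e' : Hom (colim step) C}
    (h : ∀ n, e.comp (colimIncl step n) = e'.comp (colimIncl step n)) : e = e' := by
  ext x
  obtain ⟨i, a, rfl⟩ := exists_colimIncl step x
  exact Hom.congr (h i) a

/-- Homomorphisms out of the colimit. -/
def colimDesc {C : CDGA.{v}} (c : ∀ n, Hom (F n) C) (hc : ∀ n, (c (n + 1)).comp (step n) = c n) :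
    Hom (colim step) C where
  toAlgHom := liftAlg (fun i => (c i).toAlgHom) (fun i x => Hom.congr (hc i) x)
  map_deg := by
    rintro n _ ⟨i, a, ha, rfl⟩
    exact (c i).map_deg ha
  map_d x := by
    obtain ⟨i, a, rfl⟩ := exists_colimIncl step x
    exact (c i).map_d a

theorem colimDesc_comp_incl {C : CDGA.{v}} (c : ∀ n, Hom (F n) C)
    (hc : ∀ n, (c (n + 1)).comp (step n) = c n) (n : ℕ) :
    (colimDesc c hc).comp (colimIncl step n) = c n := rfl

variable (step) in
theorem colim_isSequentialColimit : IsSequentialColimit step (colimIncl step) :=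
  ⟨colimIncl_comp_step step, fun _ c hc => ⟨colimDesc c hc, colimDesc_comp_incl c hc,
    fun _ h => colim_hom_ext fun n => (h n).trans (colimDesc_comp_incl c hc n).symm⟩⟩

end Colimit

/-! ### Skeletal filtrations -/

section Filtration

/-- Extension along the zero space. It fills the steps of a skeletal filtration where nothing is
attached: degree `1`, and all degrees past the last one. -/
theorem isHirschExtension_id (A : CDGA.{u}) (k : ℕ) : IsHirschExtension (Hom.id A) k := by
  refine ⟨PUnit.{u + 1}, inferInstance, inferInstance, 0, 0, fun _ => zero_mem _,
    fun _ => map_zero _, fun _ => zero_mem _, fun _ => map_zero _, fun C h φ _ _ => ?_⟩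
  refine ⟨h, ⟨rfl, fun v => ?_⟩, fun e he => he.1⟩
  rw [Subsingleton.elim v 0, map_zero, map_zero, map_zero]

variable {F : ℕ → CDGA.{u}} (step : ∀ n, Hom (F n) (F (n + 1)))

theorem trans_isHirschExtension (hs : ∀ n, IsHirschExtension (step n) (n + 2)) {i j k : ℕ}
    (h : i ≤ j) (hj : j = i ∨ (j = i + 1 ∧ k = i + 2)) : IsHirschExtension (trans step h) k := by
  rcases hj with rfl | ⟨rfl, rfl⟩
  · rw [trans_self]
    exact isHirschExtension_id _ _
  · rw [trans_step]
    exact hs i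

/-- A skeletal filtration of `M` obtained from a sequence of Hirsch extensions by reindexing. -/
def skeletalFiltrationOf (h0 : (F 0).IsGroundField)
    (hs : ∀ n, IsHirschExtension (step n) (n + 2)) {M : CDGA.{u}} (idx : ℕ → ℕ)
    (idx_zero : idx 0 = 0) (idx_le : ∀ k, idx k ≤ idx (k + 1))
    (idx_succ : ∀ k, idx (k + 1) = idx k ∨ (idx (k + 1) = idx k + 1 ∧ k + 1 = idx k + 2))
    (incl : ∀ k, Hom (F (idx k)) M)
    (incl_step : ∀ k, (incl (k + 1)).comp (trans step (idx_le k)) = incl k)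
    (incl_injective : ∀ k, Function.Injective (incl k))
    (exhaustive : ∀ x : M, ∃ k, x ∈ Set.range (incl k)) : SkeletalFiltration M where
  stage k := F (idx k)
  step k := trans step (idx_le k)
  incl := incl
  incl_step := incl_step
  base := by
    rw [idx_zero]
    exact h0
  hirsch k := trans_isHirschExtension step hs (idx_le k) (idx_succ k)
  incl_injective := incl_injective
  exhaustive := exhaustive

variable {step}

theorem isKMinimal_of_hirsch (h0 : (F 0).IsGroundField)
    (hs : ∀ n, IsHirschExtension (step n) (n + 2)) (hinj : ∀ n, Function.Injective (step n))
    (n : ℕ) : (F n).IsKMinimal (n + 1) := by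
  -- Stated for an arbitrary index equal to `n`, since it is applied to `min (n + 1 - 1) n`.
  have hsurj : ∀ i (h : i ≤ n), i = n → Function.Surjective (trans step h) := by
    rintro i h rfl x
    exact ⟨x, Hom.congr (trans_self step i) x⟩
  -- Truncated subtraction repeats stage `0` at levels `0` and `1`, as there are no generators in
  -- degree `1`; stage `i` then sits at level `i + 1`, and the minimum freezes the filtration from
  -- level `n + 1` on.
  exact ⟨skeletalFiltrationOf step h0 hs (fun k => min (k - 1) n) (by simp)
    (fun k => by omega) (fun k => by omega)
    (fun k => trans step (min_le_right _ _)) (fun k => trans_comp step _ _ _)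
    (fun k => trans_injective step hinj _)
    (fun x => ⟨n + 1, hsurj _ _ (by simp) x⟩), hsurj _ _ (by simp)⟩

theorem colim_isMinimal (h0 : (F 0).IsGroundField)
    (hs : ∀ n, IsHirschExtension (step n) (n + 2)) (hinj : ∀ n, Function.Injective (step n)) :
    (colim step).IsMinimal :=
  ⟨skeletalFiltrationOf step h0 hs (fun k => k - 1) rfl (fun k => by omega)
    (fun k => by omega) (fun k => colimIncl step (k - 1))
    (fun k => colimIncl_comp_trans step _) (fun k => colimIncl_injective step hinj _)
    (fun x => by
      obtain ⟨i, a, rfl⟩ := exists_colimIncl step x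
      exact ⟨i + 1, a, rfl⟩)⟩

end Filtration

/-! ### Assembling the telescope -/

section Models

variable {M A : CDGA.{u}} {m : Hom M A}

theorem cohomologyMap_injective {n : ℕ}
    (h : ∀ x ∈ M.deg n, M.d x = 0 → m x ∈ LinearMap.range A.d → x ∈ LinearMap.range M.d) :
    Function.Injective (m.cohomologyMap n) := by
  refine (injective_iff_map_eq_zero _).2 fun x hx => ?_
  obtain ⟨⟨z, hz⟩, rfl⟩ := Submodule.mkQ_surjective _ x
  exact (Submodule.Quotient.mk_eq_zero _).2
    (h z hz.1 hz.2
    ((Submodule.Quotient.mk_eq_zero ((LinearMap.range A.d).submoduleOf _)).1 hx))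

theorem cohomologyMap_surjective {n : ℕ}
    (h : ∀ a ∈ A.deg n, A.d a = 0 → ∃ x ∈ M.deg n, M.d x = 0 ∧ m x - a ∈ LinearMap.range A.d) :
    Function.Surjective (m.cohomologyMap n) := by
  intro y
  obtain ⟨⟨a, ha⟩, rfl⟩ := Submodule.mkQ_surjective _ y
  obtain ⟨x, hx, hdx, hxa⟩ := h a ha.1 ha.2
  exact ⟨Submodule.Quotient.mk ⟨x, hx, hdx⟩, (Submodule.Quotient.eq _).2 hxa⟩

theorem Hom.IsApprox.isKMinimalModel {k : ℕ} (h : m.IsApprox k) (hM : M.IsKMinimal k) :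
    m.IsKMinimalModel k :=
  ⟨hM, fun i hi => ⟨cohomologyMap_injective (h.inj i (by omega)),
    cohomologyMap_surjective (h.surj i hi)⟩, cohomologyMap_injective (h.inj (k + 1) le_rfl)⟩

/-- The unit map of a simply-connected CDGA is a `1`-minimal approximation. -/
theorem unitHom_isApprox (hA : A.IsSimplyConnected) : (unitHom.{u} A).IsApprox 1 := by
  have hpos : ∀ n, 0 < n → ∀ x ∈ ground.{u}.deg n, x = 0 := fun n hn x hx => by
    obtain ⟨n, rfl⟩ := Nat.exists_eq_succ_of_ne_zero hn.ne'
    exact hx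
  refine ⟨inferInstanceAs (Nontrivial (ULift ℚ)), fun a _ => ground_isGroundField.2 a,
    hpos 1 one_pos, fun n hn x hx => ?_, fun n hn x hx _ hmx => ?_, fun n hn a ha hda => ?_⟩
  · rw [hpos n (by omega) x hx]
    exact zero_mem _
  · rcases Nat.eq_zero_or_pos n with rfl | hn'
    -- In degree `0` a coboundary is zero, and the uniqueness part of connectedness makes the unit
    -- map injective.
    · have h0 := A.eq_zero_of_mem_range_d (Hom.map_deg _ hx) hmx
      obtain ⟨q, rfl⟩ := ground_isGroundField.2 x
      rw [IsGroundField.hom_apply_algebraMap] at h0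
      rw [(hA.1 0 (zero_mem _) (map_zero _)).unique h0 (map_zero _), map_zero]
      exact zero_mem _
    · rw [hpos n hn' x hx]
      exact zero_mem _
  · rcases Nat.eq_zero_or_pos n with rfl | hn'
    · obtain ⟨q, rfl, -⟩ := hA.1 a ha hda
      refine ⟨algebraMap ℚ _ q, ground.algebraMap_mem_deg q, ground.d_algebraMap q, ?_⟩
      rw [IsGroundField.hom_apply_algebraMap, sub_self]
      exact zero_mem _
    · obtain rfl : n = 1 := by omega
      have := hA.2
      refine ⟨0, zero_mem _, map_zero _, ?_⟩
      rw [map_zero, zero_sub]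
      refine neg_mem ?_
      have h0 : (Submodule.Quotient.mk ⟨a, ha, hda⟩ : A.Cohomology 1) = 0 := Subsingleton.elim _ _
      exact (Submodule.Quotient.mk_eq_zero ((LinearMap.range A.d).submoduleOf _)).1 h0

/-- Every cocycle of the colimit lives at a finite stage, and stage `i` is already correct in
degrees up to `i + 1`. Injectivity in degree `n` is therefore tested at stage `max i n`, where
injective inclusions keep the element a cocycle; surjectivity is read off at stage `n`. -/
theorem colim_isQuasiIso {F : ℕ → CDGA.{u}} {step : ∀ n, Hom (F n) (F (n + 1))}
    (hinj : ∀ n, Function.Injective (step n)) (c : ∀ n, Hom (F n) A)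
    (hc : ∀ n, (c (n + 1)).comp (step n) = c n) (h : ∀ n, (c n).IsApprox (n + 1)) :
    (colimDesc c hc).IsQuasiIso := by
  refine fun n => ⟨cohomologyMap_injective fun x hx hdx hmx => ?_,
    cohomologyMap_surjective fun a ha hda => ?_⟩
  · obtain ⟨i, a, ha, rfl⟩ := exists_colimIncl_of_mem step hx
    rw [← Hom.congr (colimIncl_comp_trans step (le_max_left i n)) a, Hom.comp_apply] at hdx hmx ⊢
    rw [← Hom.map_d, ← map_zero (colimIncl step (max i n)).toAlgHom] at hdx
    obtain ⟨y, hy⟩ := (h (max i n)).inj n (by omega) _ (Hom.map_deg _ ha)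
      (colimIncl_injective step hinj _ hdx) hmx
    exact ⟨colimIncl step _ y, by rw [← Hom.map_d, hy]⟩
  · obtain ⟨x, hx, hdx, hxa⟩ := (h n).surj n (by omega) a ha hda
    refine ⟨colimIncl step n x, Hom.map_deg _ hx, ?_, hxa⟩
    rw [← Hom.map_d, hdx, map_zero]

end Models

/-! ### The telescope over a map and its colimit -/

section Telescope

variable {A B : CDGA.{u}} (f : Hom A B)

/-- The trivial square `ℚ = ℚ` over `f`. -/
def groundSquare : MapSquare f where
  M := ground
  N := ground
  g := Hom.id ground
  m := unitHom A
  n := unitHom B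
  H :=
    { toHom := unitHom (tensor B interval)
      eval_zero := Hom.congr (ground_isGroundField.hom_ext
        ((evalHom B 0).comp (unitHom (tensor B interval))) _)
      eval_one := Hom.congr (ground_isGroundField.hom_ext
        ((evalHom B 1).comp (unitHom (tensor B interval))) _) }

variable {f}

/-- The colimit of a telescope. -/
def ApproximationTelescope.colimSquare (T : ApproximationTelescope f) : MapSquare f where
  M := colim fun n => (T.ext n).i
  N := colim fun n => (T.ext n).j
  g := colimDesc (fun n => (colimIncl (fun n => (T.ext n).j) n).comp (T.square n).g) fun n => by
    have h := (T.ext n).top_comm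
    have h' := colimIncl_comp_step (fun n => (T.ext n).j) n
    ext x
    exact (congrArg (colimIncl (fun n => (T.ext n).j) (n + 1)) (Hom.congr h x)).trans
      (Hom.congr h' ((T.square n).g x))
  m := colimDesc (fun n => (T.square n).m) fun n => (T.ext n).left_comm
  n := colimDesc (fun n => (T.square n).n) fun n => (T.ext n).right_comm
  H :=
    { toHom := colimDesc (fun n => (T.square n).H.toHom) fun n => (T.ext n).homotopy_comm
      eval_zero := fun x => by
        obtain ⟨i, a, rfl⟩ := exists_colimIncl _ x
        exact (T.square i).H.eval_zero a
      eval_one := fun x => by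
        obtain ⟨i, a, rfl⟩ := exists_colimIncl _ x
        exact (T.square i).H.eval_one a }

/-- The colimit of a telescope is its colimit. -/
def ApproximationTelescope.colimSquareColimit (T : ApproximationTelescope f) :
    T.Colimit T.colimSquare where
  inclM := colimIncl fun n => (T.ext n).i
  inclN := colimIncl fun n => (T.ext n).j
  colimitM := colim_isSequentialColimit _
  colimitN := colim_isSequentialColimit _
  top_comm _ := rfl
  left_comm _ := rfl
  right_comm _ := rfl
  homotopy_comm _ := rfl

theorem exists_telescope (hA : A.IsSimplyConnected) (hB : B.IsSimplyConnected) (f : Hom A B) :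
    ∃ T : ApproximationTelescope f, ∀ n, (T.square n).m.IsApprox (n + 1) ∧
      (T.square n).n.IsApprox (n + 1) ∧ Function.Injective (T.ext n).i ∧
        Function.Injective (T.ext n).j := by
  -- The recursion carries the approximation property with each square, since it is the hypothesis
  -- under which the next extension exists.
  choose next ext hm hn hi hj using fun (n : ℕ)
    (S : {S : MapSquare f // S.m.IsApprox (n + 1) ∧ S.n.IsApprox (n + 1)}) =>
      S.1.exists_coneExtension (n + 1) (by omega) S.2.1 S.2.2
  let state : ∀ n, {S : MapSquare f // S.m.IsApprox (n + 1) ∧ S.n.IsApprox (n + 1)} := fun n =>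
    Nat.rec ⟨groundSquare f, unitHom_isApprox hA, unitHom_isApprox hB⟩
      (fun n S => ⟨next n S, hm n S, hn n S⟩) n
  exact ⟨⟨fun n => (state n).1, ground_isGroundField, ground_isGroundField,
    fun n => ext n (state n)⟩, fun n => ⟨(state n).2.1, (state n).2.2, hi n _, hj n _⟩⟩

end Telescope

end CDGA

end

theorem mainTheorem4 {A B : CDGA.{u}} (hA : A.IsSimplyConnected) (hB : B.IsSimplyConnected)
    (f : CDGA.Hom A B) :
    ∃ T : CDGA.ApproximationTelescope f,
      (∀ n : ℕ, (T.square n).IsKMinimalModel (n + 1)) ∧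
      ∃ S : CDGA.MapSquare f, Nonempty (T.Colimit S) ∧ S.IsMinimalModel := by
  obtain ⟨T, hT⟩ := CDGA.exists_telescope hA hB f
  -- The square at index `n` is `(n + 1)`-minimal, so the step out of it attaches generators in
  -- degree `n + 2`.
  have hM : ∀ n, CDGA.IsHirschExtension (T.ext n).i (n + 2) :=
    fun n => ⟨_, _, _, _, _, (T.ext n).hirschM⟩
  have hN : ∀ n, CDGA.IsHirschExtension (T.ext n).j (n + 2) :=
    fun n => ⟨_, _, _, _, _, (T.ext n).hirschN⟩
  have hi : ∀ n, Function.Injective (T.ext n).i := fun n => (hT n).2.2.1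
  have hj : ∀ n, Function.Injective (T.ext n).j := fun n => (hT n).2.2.2
  refine ⟨T, fun n => ⟨(hT n).1.isKMinimalModel (CDGA.isKMinimal_of_hirsch T.baseM hM hi n),
    (hT n).2.1.isKMinimalModel (CDGA.isKMinimal_of_hirsch T.baseN hN hj n)⟩,
    T.colimSquare, ⟨T.colimSquareColimit⟩, ⟨CDGA.colim_isMinimal T.baseM hM hi, ?_⟩,
    ⟨CDGA.colim_isMinimal T.baseN hN hj, ?_⟩⟩
  · exact CDGA.colim_isQuasiIso hi _ (fun n => (T.ext n).left_comm) fun n => (hT n).1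
  · exact CDGA.colim_isQuasiIso hj _ (fun n => (T.ext n).right_comm) fun n => (hT n).2.1
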